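/- **Theorem (OIM-bisimilarity and FC-bisimilarity coincide).** Let $N=(S,A,T)$ be a finite labelled P/T net: $S$ is a finite set of places, $A$ a finite set of labels, and $T$ a finite set of transitions $t=({}^\bullet t,\,l(t),\,t^\bullet)$, where ${}^\bullet t\neq\emptyset$ and $t^\bullet$ are multisets over $S$ and $l(t)\in A$. Let $m_1,m_2$ be any two markings (multisets over $S$) of $N$; no boundedness is assumed. Then $$m_1\sim_{oim}m_2\quad\Longleftrightarrow\quad m_1\sim_{fc}m_2 .$$ The two relations are defined as follows. *Fully-concurrent bisimilarity.* A causal net $C$ is a finite acyclic P/T net, labelled over $A$, with arcs of weight at most one, whose places (conditions, taken from an arbitrary fixed infinite set of names) have at most one producing and at most one consuming transition (event). $Min(C)$, which is its initial marking, is the set of conditions without producer, and $Max(C)$ the set of conditions without consumer. A process of $N(m_0)$ is a pair $\pi=(C,\rho)$, where $\rho$ maps conditions to places and events to transitions, preserves labels and pre- and post-multisets, and maps $Min(C)$ to the multiset $m_0$. A move $\pi\xrightarrow{e}\pi'$ between processes of the same $N(m_0)$ adds to $C$ one event $e$ with ${}^\bullet e\subseteq Max(C)$ together with its post-set, keeps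 $Min$ unchanged, and extends $\rho$. Events of $C$ are partially ordered by the existence of a path. An fc-bisimulation is a set $R$ of triples $(\pi_1,f,\pi_2)$ of two processes of $N$ (each from some initial marking) and a label-preserving order isomorphism $f$ between their events, such that for each move $\pi_1\xrightarrow{e_1}\pi_1'$ there is a move $\pi_2\xrightarrow{e_2}\pi_2'$ with $(\pi_1',f\cup\{e_1\mapsto e_2\},\pi_2')\in R$, and symmetrically for moves of $\pi_2$. Then $m_1\sim_{fc}m_2$ iff some fc-bisimulation contains a triple $(\pi_1^0,\emptyset,\pi_2^0)$ in which $C_i^0$ has no events and $\rho_i^0(Min(C_i^0))=\rho_i^0(Max(C_i^0))=m_i$ for $i=1,2$. *OIM-bisimilarity.* A token is a pair $(s,i)$ with $s\in S$ and $i\ge 1$. An indexed marking $k$ is a finite set of tokens; $\alpha(k)$ is the multiset of its places; $k$ is closed if the indices used on each place $s$ are exactly $1,\dots,\alpha(k)(s)$. An ordered indexed marking (oim) is a pair $(k,\le)$ with $\le$ a preorder on $k$. The step $(k,\le)[t\rangle(k',\le')$ with untouched part $k''$ holds for $t\in T$ if $k''$ arises from $k$ by removing, for each place $s$, ${}^\bullet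 t(s)$ arbitrary tokens on $s$ (which must be present); $k'$ arises from $k''$ by adding successively, for each occurrence of a place $s$ in $t^\bullet$, the token on $s$ with the least free index; and, for $p,q\in k'$, $p\le' q$ iff either $p,q\in k''$ and $p\le q$; or $p,q\in k'\setminus k''$; or $p\in k''$, $q\in k'\setminus k''$ and $p\le r$ for some $r\in k\setminus k''$. An OIM-bisimulation is a set $\mathfrak B$ of triples $((k_1,\le_1),(k_2,\le_2),\beta)$ of two oims and a relation $\beta$ on tokens such that, for each step $(k_1,\le_1)[t_1\rangle(k_1',\le_1')$ with untouched part $k_1''$, there is a step $(k_2,\le_2)[t_2\rangle(k_2',\le_2')$ with some untouched part $k_2''$ such that * $l(t_1)=l(t_2)$, and $((k_1',\le_1'),(k_2',\le_2'),\beta')\in\mathfrak B$, where $\beta'=\big(\beta\cap(k_1''\times k_2'')\big)\cup\big((k_1'\setminus k_1'')\times(k_2'\setminus k_2'')\big)$; * for all $p_1\in k_1\setminus k_1''$ there are $p_1'\in k_1\setminus k_1''$ and $p_2'\in k_2\setminus k_2''$ with $p_1\le_1p_1'$ and $p_1'\mathrel\beta p_2'$; and for all $p_2\in k_2\setminus k_2''$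 there are $p_2'\in k_2\setminus k_2''$ and $p_1'\in k_1\setminus k_1''$ with $p_2\le_2p_2'$ and $p_1'\mathrel\beta p_2'$; and symmetrically when the second oim moves first. Then $m_1\sim_{oim}m_2$ iff some OIM-bisimulation contains $\big((k_1,k_1\times k_1),(k_2,k_2\times k_2),k_1\times k_2\big)$, where $k_i$ is the closed indexed marking with $\alpha(k_i)=m_i$. -/

import Mathlib

/-- A transition `(pre, label, post)` over places `S` and labels `A`: `pre` is the multiset of
consumed tokens, `post` the multiset of produced tokens. -/
@[ext] structure Transition (S A : Type*) where
  pre : Multiset S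
  label : A
  post : Multiset S

/-- A labelled Place/Transition net `(S, A, T)`: a finite set `T` of transitions whose pre-sets are
nonempty. (Finiteness of `S` and `A` is imposed where nets are used.) -/
structure PTNet (S A : Type*) where
  trans : Finset (Transition S A)
  pre_ne : ∀ t ∈ trans, t.pre ≠ 0

/-! ### Causal nets -/

/-- The flow relation `F` of a set `E` of transitions, on the disjoint union of places and
transitions. -/
def flow {U A : Type*} (E : Finset (Transition U A)) :
    U ⊕ Transition U A → U ⊕ Transition U A → Prop
  | Sum.inl b, Sum.inr e => e ∈ E ∧ b ∈ e.pre
  | Sum.inr e, Sum.inl b => e ∈ E ∧ b ∈ e.post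
  | _, _ => False

open Classical in
/-- The pre-set of a place `b`: the transitions in `E` that produce `b`. -/
noncomputable def producers {U A : Type*} (E : Finset (Transition U A)) (b : U) :
    Finset (Transition U A) :=
  E.filter (fun e => b ∈ e.post)

open Classical in
/-- The post-set of a place `b`: the transitions in `E` that consume `b`. -/
noncomputable def consumers {U A : Type*} (E : Finset (Transition U A)) (b : U) :
    Finset (Transition U A) :=
  E.filter (fun e => b ∈ e.pre)

/-- A (finite) causal net with conditions taken from the supply `U` of names and with label set
`A`. Its initial marking is determined by its shape, see `CausalNet.minConds`. -/
structure CausalNet (U A : Type*) where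
  conds : Finset U
  events : Finset (Transition U A)
  pre_ne : ∀ e ∈ events, e.pre ≠ 0
  pre_subset : ∀ e ∈ events, ∀ b ∈ e.pre, b ∈ conds
  post_subset : ∀ e ∈ events, ∀ b ∈ e.post, b ∈ conds
  acyclic : ∀ x, ¬ Relation.TransGen (flow events) x x
  producers_le_one : ∀ b ∈ conds, (producers events b).card ≤ 1
  consumers_le_one : ∀ b ∈ conds, (consumers events b).card ≤ 1
  /- all arcs have weight one -/
  pre_nodup : ∀ e ∈ events, e.pre.Nodup
  post_nodup : ∀ e ∈ events, e.post.Nodup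

namespace CausalNet

variable {U A : Type*}

open Classical in
/-- `Min(C)`, the initial marking: the conditions that no event produces. -/
noncomputable def minConds (C : CausalNet U A) : Finset U :=
  C.conds.filter (fun b => producers C.events b = ∅)

open Classical in
/-- `Max(C)`: the conditions that no event consumes. -/
noncomputable def maxConds (C : CausalNet U A) : Finset U :=
  C.conds.filter (fun b => consumers C.events b = ∅)

/-- The partial order of events: there is a path in the net from `e` to `e'`. -/
def precedes (C : CausalNet U A) (e e' : Transition U A) : Prop :=
  Relation.ReflTransGen (flow C.events) (Sum.inr e) (Sum.inr e')

open Classical in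
/-- `C [e⟩ C'`: the causal net `C` moves in one step to `C'` through the event `e`. The two nets
have the same initial marking. -/
def Step (C : CausalNet U A) (e : Transition U A) (C' : CausalNet U A) : Prop :=
  e.pre ≤ C.maxConds.val ∧
  C'.events = insert e C.events ∧
  C'.conds = C.conds ∪ e.post.toFinset ∧
  C'.minConds = C.minConds

end CausalNet

/-! ### Foldings of causal nets -/

/-- A pair `(C, ρ)` of a causal net and a type-preserving partial map `ρ` from conditions to places
and from events to transitions. -/
structure FoldedNet (U S A : Type*) where
  net : CausalNet U A
  onCond : U → Option S
  onEvent : Transition U A → Option (Transition S A)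

namespace FoldedNet

variable {U S A : Type*}

/-- `π = (C, ρ)` is a process of the marked net `N(m₀)`: `ρ` is a folding, with domain exactly the
conditions and events of `C`. -/
structure IsProcessOf (N : PTNet S A) (m₀ : Multiset S) (π : FoldedNet U S A) : Prop where
  cond_dom : ∀ b, (∃ s, π.onCond b = some s) ↔ b ∈ π.net.conds
  event_dom : ∀ e, (∃ t, π.onEvent e = some t) ↔ e ∈ π.net.events
  event_mem : ∀ e t, π.onEvent e = some t → t ∈ N.trans
  label_eq : ∀ e t, π.onEvent e = some t → e.label = t.label
  map_init : π.net.minConds.val.map π.onCond = m₀.map some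
  map_pre : ∀ e t, π.onEvent e = some t → e.pre.map π.onCond = t.pre.map some
  map_post : ∀ e t, π.onEvent e = some t → e.post.map π.onCond = t.post.map some

/-- The process `π` of `N` moves in one step to the process `π'` through the event `e`: both are
processes of the same marked net, the causal net moves through `e`, and `ρ ⊆ ρ'`. -/
def Step (N : PTNet S A) (π : FoldedNet U S A) (e : Transition U A) (π' : FoldedNet U S A) : Prop :=
  (∃ m₀, IsProcessOf N m₀ π ∧ IsProcessOf N m₀ π') ∧
  π.net.Step e π'.net ∧
  (∀ b s, π.onCond b = some s → π'.onCond b = some s) ∧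
  (∀ x t, π.onEvent x = some t → π'.onEvent x = some t)

end FoldedNet

/-! ### Fully-concurrent bisimilarity -/

/-- `f`, given by its graph, is an isomorphism between the labelled partial orders of events of
`C₁` and `C₂`. -/
structure IsEventIso {U A : Type*} (C₁ C₂ : CausalNet U A)
    (f : Set (Transition U A × Transition U A)) : Prop where
  mem : ∀ e₁ e₂, (e₁, e₂) ∈ f → e₁ ∈ C₁.events ∧ e₂ ∈ C₂.events
  left : ∀ e₁ ∈ C₁.events, ∃! e₂, (e₁, e₂) ∈ f
  right : ∀ e₂ ∈ C₂.events, ∃! e₁, (e₁, e₂) ∈ f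
  order : ∀ e₁ e₂ e₁' e₂', (e₁, e₂) ∈ f → (e₁', e₂') ∈ f →
    (C₁.precedes e₁ e₁' ↔ C₂.precedes e₂ e₂')
  label : ∀ e₁ e₂, (e₁, e₂) ∈ f → e₁.label = e₂.label

/-- `R` is a fully-concurrent bisimulation on the net `N`. -/
structure IsFCBisimulation {U S A : Type*} (N : PTNet S A)
    (R : FoldedNet U S A → Set (Transition U A × Transition U A) → FoldedNet U S A → Prop) :
    Prop where
  process_left : ∀ π₁ f π₂, R π₁ f π₂ → ∃ m₀, π₁.IsProcessOf N m₀
  process_right : ∀ π₁ f π₂, R π₁ f π₂ → ∃ m₀, π₂.IsProcessOf N m₀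
  iso : ∀ π₁ f π₂, R π₁ f π₂ → IsEventIso π₁.net π₂.net f
  forth : ∀ π₁ f π₂, R π₁ f π₂ → ∀ e₁ π₁', FoldedNet.Step N π₁ e₁ π₁' →
    ∃ e₂ π₂', FoldedNet.Step N π₂ e₂ π₂' ∧ R π₁' (insert (e₁, e₂) f) π₂'
  back : ∀ π₁ f π₂, R π₁ f π₂ → ∀ e₂ π₂', FoldedNet.Step N π₂ e₂ π₂' →
    ∃ e₁ π₁', FoldedNet.Step N π₁ e₁ π₁' ∧ R π₁' (insert (e₁, e₂) f) π₂'

/-- The process `π` has no events and `ρ(Min(C)) = ρ(Max(C)) = m`. -/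
def FoldedNet.IsInitial {U S A : Type*} (m : Multiset S) (π : FoldedNet U S A) : Prop :=
  π.net.events = ∅ ∧
  π.net.minConds.val.map π.onCond = m.map some ∧
  π.net.maxConds.val.map π.onCond = m.map some

/-- `m₁ ∼fc m₂`, with the conditions of causal nets taken from the supply `U` of names. -/
def FCBisimilar (U : Type*) {S A : Type*} (N : PTNet S A) (m₁ m₂ : Multiset S) : Prop :=
  ∃ R : FoldedNet U S A → Set (Transition U A × Transition U A) → FoldedNet U S A → Prop,
    IsFCBisimulation N R ∧
    ∃ π₁ π₂, π₁.IsInitial m₁ ∧ π₂.IsInitial m₂ ∧ R π₁ ∅ π₂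

/-! ### Indexed markings -/

/-- A token (indexed place): a place together with a positive index. -/
abbrev Token (S : Type*) := S × ℕ+

/-- An indexed marking: a finite set of tokens. -/
abbrev IndexedMarking (S : Type*) := Finset (Token S)

namespace IndexedMarking

variable {S : Type*}

/-- The de-indexed marking `α(k)`. -/
def toMarking (k : IndexedMarking S) : Multiset S := k.val.map Prod.fst

open Classical in
/-- `k` is closed: the indices of the tokens on `s` are exactly `1, …, |k(s)|`. -/
def IsClosed (k : IndexedMarking S) : Prop :=
  ∀ (s : S) (i : ℕ+), (s, i) ∈ k ↔ (i : ℕ) ≤ k.toMarking.count s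

theorem exists_free (k : IndexedMarking S) (s : S) : ∃ i : ℕ+, (s, i) ∉ k := by
  by_contra! h
  exact Set.infinite_of_injective_forall_mem (s := (k : Set (Token S)))
    (f := fun i : ℕ+ => (s, i)) (fun i j hij => (Prod.mk.inj hij).2) h k.finite_toSet

open Classical in
/-- The least index that is free on the place `s`. -/
noncomputable def freeIndex (k : IndexedMarking S) (s : S) : ℕ+ := PNat.find (exists_free k s)

open Classical in
/-- `k ⊞ s` for a single place `s`: add the token on `s` with the least free index. -/
noncomputable def addOne (k : IndexedMarking S) (s : S) : IndexedMarking S :=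
  insert (s, freeIndex k s) k

theorem freeIndex_congr {k k' : IndexedMarking S} {s : S}
    (h : ∀ i, (s, i) ∈ k ↔ (s, i) ∈ k') : freeIndex k s = freeIndex k' s := by
  classical
  apply le_antisymm
  · exact PNat.find_min' _ fun hi => PNat.find_spec (exists_free k' s) ((h _).1 hi)
  · exact PNat.find_min' _ fun hi => PNat.find_spec (exists_free k s) ((h _).2 hi)

theorem addOne_comm (k : IndexedMarking S) (s s' : S) :
    addOne (addOne k s) s' = addOne (addOne k s') s := by
  classical
  by_cases hs : s = s'
  · rw [hs]
  · have h1 : freeIndex (addOne k s) s' = freeIndex k s' :=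
      freeIndex_congr fun i => by simp [addOne, Ne.symm hs]
    have h2 : freeIndex (addOne k s') s = freeIndex k s :=
      freeIndex_congr fun i => by simp [addOne, hs]
    rw [addOne, h1, addOne, addOne, h2, addOne, Finset.insert_comm]

instance : RightCommutative (addOne (S := S)) := ⟨addOne_comm⟩

/-- `k ⊞ m`, with `k ⊞ 0 = k` and `k ⊞ (s ⊕ m) = (k ⊞ s) ⊞ m`. -/
noncomputable def add (k : IndexedMarking S) (m : Multiset S) : IndexedMarking S :=
  m.foldl addOne k

open Classical in
/-- `K ⊟ s` for a set `K` of indexed markings and a single place `s`: remove an arbitrary token on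
`s` from some member of `K`. -/
def subOne (K : Set (IndexedMarking S)) (s : S) : Set (IndexedMarking S) :=
  {k' | ∃ k ∈ K, ∃ i : ℕ+, (s, i) ∈ k ∧ k' = k.erase (s, i)}

theorem subOne_comm (K : Set (IndexedMarking S)) (s s' : S) :
    subOne (subOne K s) s' = subOne (subOne K s') s := by
  classical
  have key : ∀ s s', subOne (subOne K s) s' ⊆ subOne (subOne K s') s := by
    rintro s s' _ ⟨_, ⟨k, hk, i, hi, rfl⟩, j, hj, rfl⟩
    rw [Finset.mem_erase] at hj
    refine ⟨k.erase (s', j), ⟨k, hk, j, hj.2, by congr⟩, i, ?_, ?_⟩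
    · rw [Finset.mem_erase]
      exact ⟨Ne.symm hj.1, hi⟩
    · ext x
      simp only [Finset.mem_erase]
      tauto
  exact Set.Subset.antisymm (key s s') (key s' s)

instance : RightCommutative (subOne (S := S)) := ⟨subOne_comm⟩

/-- `k ⊟ m`, the set of indexed markings obtained from `k` by removing tokens according to `m`:
`k ⊟ 0 = {k}` and `k ⊟ (s ⊕ m) = (k ⊟ s) ⊟ m`. -/
def sub (k : IndexedMarking S) (m : Multiset S) : Set (IndexedMarking S) :=
  m.foldl subOne {k}

end IndexedMarking

/-! ### Ordered indexed markings -/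

/-- An ordered indexed marking `(k, ≤)`: an indexed marking with a preorder `≤ ⊆ k × k` on it. -/
@[ext] structure OIM (S : Type*) where
  tokens : IndexedMarking S
  le : Token S → Token S → Prop
  le_mem : ∀ p q, le p q → p ∈ tokens ∧ q ∈ tokens
  le_refl : ∀ p ∈ tokens, le p p
  le_trans : ∀ p q r, le p q → le q r → le p r

namespace OIM

variable {S A : Type*}

/-- The initial ordered indexed marking `(k, k × k)`. -/
def init (k : IndexedMarking S) : OIM S where
  tokens := k
  le p q := p ∈ k ∧ q ∈ k
  le_mem _ _ h := h
  le_refl _ h := ⟨h, h⟩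
  le_trans _ _ _ h h' := ⟨h.1, h'.2⟩

open Classical in
/-- `(k, ≤) [t⟩ (k', ≤')`, where `u` (`k''` in the usual notation) is the untouched part of `k`.
The deleted tokens are those of `k \ u`, the generated ones those of `k' \ u`. -/
def Fires (N : PTNet S A) (O : OIM S) (t : Transition S A) (u : IndexedMarking S) (O' : OIM S) :
    Prop :=
  t ∈ N.trans ∧
  t.pre ≤ O.tokens.toMarking ∧
  u ∈ O.tokens.sub t.pre ∧
  O'.tokens = u.add t.post ∧
  ∀ p ∈ O'.tokens, ∀ q ∈ O'.tokens, O'.le p q ↔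
    (p ∈ u ∧ q ∈ u ∧ O.le p q) ∨
    (p ∈ O'.tokens \ u ∧ q ∈ O'.tokens \ u) ∨
    (p ∈ u ∧ q ∈ O'.tokens \ u ∧ ∃ r ∈ O.tokens \ u, O.le p r)

end OIM

/-! ### OIM-bisimilarity -/

open Classical in
/-- The relation `β'`: pairs of untouched tokens related by `β`, and pairs of generated tokens. Here
`uᵢ` is the untouched part of the `i`-th marking and `kᵢ'` its successor. -/
def nextRel {S : Type*} (β : Token S → Token S → Prop) (u₁ k₁' u₂ k₂' : IndexedMarking S)
    (p₁ p₂ : Token S) : Prop :=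
  (p₁ ∈ u₁ ∧ p₂ ∈ u₂ ∧ β p₁ p₂) ∨ (p₁ ∈ k₁' \ u₁ ∧ p₂ ∈ k₂' \ u₂)

open Classical in
/-- The requirement on the consumed tokens `kᵢ \ uᵢ`: each token consumed on one side precedes a
token consumed on the same side that is related by `β` to a token consumed on the other side. -/
def ConsumptionMatch {S : Type*} (O₁ O₂ : OIM S) (β : Token S → Token S → Prop)
    (u₁ u₂ : IndexedMarking S) : Prop :=
  (∀ p₁ ∈ O₁.tokens \ u₁, ∃ p₁' ∈ O₁.tokens \ u₁, ∃ p₂' ∈ O₂.tokens \ u₂,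
    O₁.le p₁ p₁' ∧ β p₁' p₂') ∧
  (∀ p₂ ∈ O₂.tokens \ u₂, ∃ p₂' ∈ O₂.tokens \ u₂, ∃ p₁' ∈ O₁.tokens \ u₁,
    O₂.le p₂ p₂' ∧ β p₁' p₂')

/-- `B` is an OIM-bisimulation on the net `N`. -/
structure IsOIMBisimulation {S A : Type*} (N : PTNet S A)
    (B : OIM S → OIM S → (Token S → Token S → Prop) → Prop) : Prop where
  forth : ∀ O₁ O₂ β, B O₁ O₂ β → ∀ t₁ u₁ O₁', O₁.Fires N t₁ u₁ O₁' →
    ∃ t₂ u₂ O₂', O₂.Fires N t₂ u₂ O₂' ∧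
      B O₁' O₂' (nextRel β u₁ O₁'.tokens u₂ O₂'.tokens) ∧
      t₁.label = t₂.label ∧ ConsumptionMatch O₁ O₂ β u₁ u₂
  back : ∀ O₁ O₂ β, B O₁ O₂ β → ∀ t₂ u₂ O₂', O₂.Fires N t₂ u₂ O₂' →
    ∃ t₁ u₁ O₁', O₁.Fires N t₁ u₁ O₁' ∧
      B O₁' O₂' (nextRel β u₁ O₁'.tokens u₂ O₂'.tokens) ∧
      t₁.label = t₂.label ∧ ConsumptionMatch O₁ O₂ β u₁ u₂

/-- `m₁ ∼oim m₂`: some OIM-bisimulation contains `(init(N(k₁)), init(N(k₂)), k₁ × k₂)`, where `kᵢ`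
is the initial (i.e. closed) indexed marking with `α(kᵢ) = mᵢ`. -/
def OIMBisimilar {S A : Type*} (N : PTNet S A) (m₁ m₂ : Multiset S) : Prop :=
  ∃ B : OIM S → OIM S → (Token S → Token S → Prop) → Prop,
    IsOIMBisimulation N B ∧
    ∃ k₁ k₂ : IndexedMarking S,
      k₁.IsClosed ∧ k₁.toMarking = m₁ ∧ k₂.IsClosed ∧ k₂.toMarking = m₂ ∧
      B (OIM.init k₁) (OIM.init k₂) (fun p₁ p₂ => p₁ ∈ k₁ ∧ p₂ ∈ k₂)

/-! An ordered indexed marking is what remains of a process once everything except its maximal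
conditions is forgotten. Tokens stand for maximal conditions, and `p ≤ q` says that the producer of
`p` reaches `q`. A condition without producer is thus below every condition, which explains the
initial preorder `k × k`. Likewise `β` remembers, of an isomorphism `f` between events, only which
maximal conditions have corresponding producers, or are both initial. Adding an event changes the
causal preorder and this correspondence exactly as the rules for `≤'` and `β'` prescribe
(`TokenStep.le_iff`, `nextRel_iff`).

It remains to compare the requirements on a pair of moves. New events are maximal, so `f ∪ {e₁ ↦
e₂}` preserves and reflects the order iff `f` matches the causes of `e₁` with those of `e₂`
(`SameCauses`). The causes of an event are the events below the producers of its preconditions, so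
they are determined by the maximal ones among these producers. The consumption clause compares just
these. If it holds, a cause of `e₁` lies below the producer of a matched precondition, and `f`
carries it below a precondition of `e₂` (`PreMatch.reaches`). Conversely, an order isomorphism
matches maximal causes with maximal causes, and a maximal cause directly produces a consumed
condition (`SameCauses.preMatch`).

Each kind of bisimulation therefore induces the other: relate all processes and ordered indexed
markings that represent the same states (`PairLinked`). `Linked.exists_fires` and
`Linked.exists_step` translate single moves. The indices of tokens only serve as names, so
boundedness plays no role. -/

/-! ### Tokens and indexed markings -/

namespace IndexedMarking

variable {S : Type*}

open Classical in
theorem toMarking_sdiff {k u : IndexedMarking S} {m : Multiset S} (h : u ⊆ k)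
    (hm : k.toMarking = u.toMarking + m) : (k \ u).val.map Prod.fst = m := by
  have h1 : u.val + (k \ u).val = k.val := by
    rw [Finset.sdiff_val]
    exact add_tsub_cancel_of_le (Finset.val_le_iff.2 h)
  have h2 := congrArg (Multiset.map Prod.fst) h1
  rw [Multiset.map_add] at h2
  exact add_left_cancel (h2.trans hm)

open Classical in
theorem toMarking_eq_add {k u : IndexedMarking S} {m : Multiset S} (h : u ⊆ k)
    (hm : (k \ u).val.map Prod.fst = m) : k.toMarking = u.toMarking + m := by
  have h1 : u.val + (k \ u).val = k.val := by
    rw [Finset.sdiff_val]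
    exact add_tsub_cancel_of_le (Finset.val_le_iff.2 h)
  have h2 := congrArg (Multiset.map Prod.fst) h1
  rw [Multiset.map_add, hm] at h2
  exact h2.symm

open Classical in
theorem toMarking_erase {k : IndexedMarking S} {p : Token S} (h : p ∈ k) :
    k.toMarking = p.1 ::ₘ toMarking (k.erase p) := by
  unfold toMarking
  conv_lhs => rw [← Finset.insert_erase h]
  rw [Finset.insert_val_of_notMem (Finset.notMem_erase _ _), Multiset.map_cons]

/-- Tokens may be removed in any order, so only the places of the missing tokens matter. `K` is
general because each removal replaces the set of candidates. -/
theorem mem_foldl_subOne (m : Multiset S) : ∀ (K : Set (IndexedMarking S)) (u : IndexedMarking S),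
    u ∈ m.foldl subOne K ↔ ∃ k ∈ K, u ⊆ k ∧ k.toMarking = u.toMarking + m := by
  classical
  induction m using Multiset.induction_on with
  | empty =>
    intro K u
    simp only [Multiset.foldl_zero, add_zero]
    refine ⟨fun h => ⟨u, h, subset_rfl, rfl⟩, ?_⟩
    rintro ⟨k, hk, hu, hm⟩
    have hc := congrArg Multiset.card hm
    simp only [toMarking, Multiset.card_map] at hc
    rwa [Finset.eq_of_subset_of_card_le hu hc.le]
  | cons s m ih =>
    intro K u
    rw [Multiset.foldl_cons, ih]
    constructor
    · rintro ⟨_, ⟨k, hk, i, hi, rfl⟩, hu, hm⟩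
      refine ⟨k, hk, fun x hx => Finset.mem_of_mem_erase (hu hx), ?_⟩
      rw [toMarking_erase hi, Multiset.add_cons]
      congr 1
    · rintro ⟨k, hk, hu, hm⟩
      have hs : s ∈ (k \ u).val.map Prod.fst := by
        rw [toMarking_sdiff hu hm]
        exact Multiset.mem_cons_self _ _
      obtain ⟨⟨s', i⟩, hp, rfl⟩ := Multiset.mem_map.1 hs
      rw [Finset.mem_val, Finset.mem_sdiff] at hp
      refine ⟨k.erase (s', i), ⟨k, hk, i, hp.1, by congr⟩, ?_, ?_⟩
      · intro x hx
        exact Finset.mem_erase.2 ⟨fun h => hp.2 (h ▸ hx), hu hx⟩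
      · rw [toMarking_erase hp.1, Multiset.add_cons] at hm
        exact (Multiset.cons_inj_right _).1 hm

theorem mem_sub_iff {k u : IndexedMarking S} {m : Multiset S} :
    u ∈ k.sub m ↔ u ⊆ k ∧ k.toMarking = u.toMarking + m := by
  simp [sub, mem_foldl_subOne]

/-- This uses only that the chosen index is free, not that it is least. -/
theorem subset_add_and_toMarking_add (m : Multiset S) : ∀ k : IndexedMarking S,
    k ⊆ k.add m ∧ (k.add m).toMarking = k.toMarking + m := by
  classical
  induction m using Multiset.induction_on with
  | empty => simp [add]
  | cons s m ih =>
    intro k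
    have hadd : k.add (s ::ₘ m) = (k.addOne s).add m := Multiset.foldl_cons _ _ _ _
    have hfree : (s, freeIndex k s) ∉ k := PNat.find_spec (exists_free k s)
    have hone : (k.addOne s).toMarking = s ::ₘ k.toMarking := by
      unfold addOne toMarking
      rw [Finset.insert_val_of_notMem (by convert hfree), Multiset.map_cons]
    have hsub : k ⊆ k.addOne s := fun x hx => Finset.mem_insert_of_mem hx
    rw [hadd]
    refine ⟨hsub.trans (ih _).1, ?_⟩
    rw [(ih _).2, hone, Multiset.cons_add, Multiset.add_cons]

theorem exists_isClosed (m : Multiset S) :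
    ∃ k : IndexedMarking S, k.IsClosed ∧ k.toMarking = m := by
  classical
  -- `toEnumFinset` numbers the copies of a place from 0, tokens are numbered from 1; hence
  -- `succPNat`.
  have hinj : Function.Injective fun x : S × ℕ => ((x.1, x.2.succPNat) : Token S) := by
    rintro ⟨s, i⟩ ⟨s', j⟩ h
    simpa using h
  have hm : toMarking (m.toEnumFinset.map ⟨_, hinj⟩) = m := by
    simp [toMarking, Multiset.map_map]
  refine ⟨m.toEnumFinset.map ⟨_, hinj⟩, ?_, hm⟩
  intro s i
  rw [hm]
  have key : (s, i) ∈ m.toEnumFinset.map ⟨_, hinj⟩ ↔ (i : ℕ) ≤ m.count s := by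
    simp only [Finset.mem_map, Function.Embedding.coeFn_mk, Prod.mk.injEq, Prod.exists,
      Multiset.mem_toEnumFinset]
    constructor
    · rintro ⟨s', n, hn, rfl, rfl⟩
      simpa using hn
    · intro hi
      refine ⟨s, i.natPred, ?_, rfl, i.succPNat_natPred⟩
      have := PNat.natPred_add_one i
      omega
  convert key

end IndexedMarking

/-! ### Naming tokens by conditions -/

/-- A finite set of tokens can be named injectively by names outside a given finite set. -/
theorem exists_fresh_names {α U : Type*} [Infinite U] (g : α → U) (K : Finset U) (G : Finset α) :
    ∃ g' : α → U, Set.InjOn g' G ∧ (∀ p ∈ G, g' p ∉ K) ∧ ∀ p ∉ G, g' p = g p := by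
  classical
  induction G using Finset.induction_on with
  | empty => exact ⟨g, by simp, by simp, by simp⟩
  | insert a G ha ih =>
    obtain ⟨g', hinj, hK, hg⟩ := ih
    obtain ⟨v, hv⟩ := Infinite.exists_notMem_finset (K ∪ G.image g')
    simp only [Finset.mem_union, Finset.mem_image, not_or, not_exists, not_and] at hv
    have hne : ∀ p ∈ G, p ≠ a := fun p hp h => ha (h ▸ hp)
    refine ⟨Function.update g' a v, ?_, ?_, ?_⟩
    · intro p hp q hq h
      simp only [Finset.coe_insert, Set.mem_insert_iff, Finset.mem_coe] at hp hq
      rcases hp with rfl | hp <;> rcases hq with rfl | hq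
      · rfl
      · rw [Function.update_self, Function.update_of_ne (hne q hq)] at h
        exact absurd h.symm (hv.2 q hq)
      · rw [Function.update_self, Function.update_of_ne (hne p hp)] at h
        exact absurd h (hv.2 p hp)
      · rw [Function.update_of_ne (hne q hq), Function.update_of_ne (hne p hp)] at h
        exact hinj hp hq h
    · intro p hp
      rcases Finset.mem_insert.1 hp with rfl | hp
      · rw [Function.update_self]
        exact hv.1
      · rw [Function.update_of_ne (hne p hp)]
        exact hK p hp
    · intro p hp
      rw [Finset.mem_insert, not_or] at hp
      rw [Function.update_of_ne hp.1, hg p hp.2]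

/-- Two finite sets with the same multiset of colours are related by a colour-preserving
bijection. -/
theorem exists_bijOn_of_map_eq {α U σ : Type*} (c : α → σ) (d : U → σ) (g : α → U) (G : Finset α) :
    ∀ F : Finset U, G.val.map c = F.val.map d →
      ∃ g' : α → U, Set.BijOn g' G F ∧ (∀ p ∈ G, d (g' p) = c p) ∧ ∀ p ∉ G, g' p = g p := by
  classical
  induction G using Finset.induction_on with
  | empty =>
    intro F hF
    have : F = ∅ := by simpa [eq_comm] using hF
    subst this
    exact ⟨g, by simp, by simp, by simp⟩
  | insert a G ha ih =>
    intro F hF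
    rw [Finset.insert_val_of_notMem ha, Multiset.map_cons] at hF
    have hca : c a ∈ F.val.map d := hF ▸ Multiset.mem_cons_self _ _
    obtain ⟨v, hv, hdv⟩ := Multiset.mem_map.1 hca
    have hv' : v ∈ F := hv
    have hF' : G.val.map c = (F.erase v).val.map d := by
      rw [← Finset.insert_erase hv', Finset.insert_val_of_notMem (Finset.notMem_erase _ _),
        Multiset.map_cons, hdv] at hF
      exact (Multiset.cons_inj_right _).1 hF
    obtain ⟨g', hbij, hd, hg⟩ := ih _ hF'
    have hne : ∀ p ∈ G, p ≠ a := fun p hp h => ha (h ▸ hp)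
    have heq : Set.EqOn g' (Function.update g' a v) G :=
      fun p hp => (Function.update_of_ne (hne p hp) _ _).symm
    refine ⟨Function.update g' a v, ?_, ?_, ?_⟩
    · have h1 := (hbij.congr heq).insert (a := a) (by simp)
      rw [Function.update_self, ← Finset.coe_insert, ← Finset.coe_insert,
        Finset.insert_erase hv'] at h1
      exact h1
    · intro p hp
      rcases Finset.mem_insert.1 hp with rfl | hp
      · rw [Function.update_self, hdv]
      · rw [← heq hp, hd p hp]
    · intro p hp
      rw [Finset.mem_insert, not_or] at hp
      rw [Function.update_of_ne hp.1, hg p hp.2]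

open Classical in
/-- The place of a condition `b`: that of the token in `G` named `b` by `g`, if any, and `d b`
otherwise. -/
noncomputable def placeOf {U S : Type*} (g : Token S → U) (G : Finset (Token S))
    (d : U → Option S) (b : U) : Option S :=
  if h : ∃ p ∈ G, g p = b then some h.choose.1 else d b

theorem placeOf_apply {U S : Type*} {g : Token S → U} {G : Finset (Token S)}
    (d : U → Option S) (hg : Set.InjOn g G) {p : Token S} (hp : p ∈ G) :
    placeOf g G d (g p) = some p.1 := by
  have h : ∃ q ∈ G, g q = g p := ⟨p, hp, rfl⟩
  rw [placeOf, dif_pos h, hg h.choose_spec.1 hp h.choose_spec.2]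

theorem placeOf_of_notMem {U S : Type*} {g : Token S → U} {G : Finset (Token S)}
    (d : U → Option S) {b : U} (hb : ∀ p ∈ G, g p ≠ b) : placeOf g G d b = d b :=
  dif_neg fun ⟨p, hp, h⟩ => hb p hp h

/-! ### Paths in causal nets -/

namespace CausalNet

variable {U A : Type*} {C C' : CausalNet U A} {e : Transition U A}

theorem mem_minConds {b : U} :
    b ∈ C.minConds ↔ b ∈ C.conds ∧ ∀ x ∈ C.events, b ∉ x.post := by
  classical
  rw [minConds, Finset.mem_filter, producers, Finset.filter_eq_empty_iff]

theorem mem_maxConds {b : U} :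
    b ∈ C.maxConds ↔ b ∈ C.conds ∧ ∀ x ∈ C.events, b ∉ x.pre := by
  classical
  rw [maxConds, Finset.mem_filter, consumers, Finset.filter_eq_empty_iff]

theorem producer_unique {x y : Transition U A} {b : U} (hx : x ∈ C.events) (hbx : b ∈ x.post)
    (hy : y ∈ C.events) (hby : b ∈ y.post) : x = y :=
  Finset.card_le_one.1 (C.producers_le_one b (C.post_subset x hx b hbx)) x
    (by simp [producers, hx, hbx]) y (by simp [producers, hy, hby])

/-- There is a path from `x` to `y`. -/
def Reaches (C : CausalNet U A) (x y : U ⊕ Transition U A) : Prop :=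
  Relation.ReflTransGen (flow C.events) x y

theorem reaches_post {x : Transition U A} {b : U} (hx : x ∈ C.events) (hb : b ∈ x.post) :
    C.Reaches (Sum.inr x) (Sum.inl b) :=
  Relation.ReflTransGen.single ⟨hx, hb⟩

theorem reaches_pre {x : Transition U A} {b : U} (hx : x ∈ C.events) (hb : b ∈ x.pre) :
    C.Reaches (Sum.inl b) (Sum.inr x) :=
  Relation.ReflTransGen.single ⟨hx, hb⟩

theorem Reaches.trans {x y z : U ⊕ Transition U A} (h : C.Reaches x y) (h' : C.Reaches y z) :
    C.Reaches x z :=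
  Relation.ReflTransGen.trans h h'

/-- The last arc of a path into a condition leaves a producer of it. This turns statements about
conditions into statements about their producers. -/
theorem Reaches.exists_producer {x : Transition U A} {b : U}
    (h : C.Reaches (Sum.inr x) (Sum.inl b)) :
    ∃ y ∈ C.events, b ∈ y.post ∧ C.Reaches (Sum.inr x) (Sum.inr y) := by
  rcases Relation.ReflTransGen.cases_tail h with h | ⟨z, hz, hzb⟩
  · cases h
  · rcases z with c | y
    · exact hzb.elim
    · exact ⟨y, hzb.1, hzb.2, hz⟩

theorem Reaches.exists_pre {x y : Transition U A} (h : C.Reaches (Sum.inr x) (Sum.inr y))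
    (hne : x ≠ y) : ∃ b ∈ y.pre, y ∈ C.events ∧ C.Reaches (Sum.inr x) (Sum.inl b) := by
  rcases Relation.ReflTransGen.cases_tail h with h | ⟨z, hz, hzb⟩
  · exact absurd (Sum.inr.inj h).symm hne
  · rcases z with c | y
    · exact ⟨c, hzb.2, hzb.1, hz⟩
    · exact hzb.elim

theorem Reaches.antisymm {x y : U ⊕ Transition U A} (h : C.Reaches x y) (h' : C.Reaches y x) :
    x = y := by
  by_contra hne
  rcases Relation.reflTransGen_iff_eq_or_transGen.1 h with h | h
  · exact hne h.symm
  · exact C.acyclic x (h.trans_left h')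

/-- The causal preorder on conditions: whatever produces `b` reaches `b'`. -/
def condLe (C : CausalNet U A) (b b' : U) : Prop :=
  ∀ x ∈ C.events, b ∈ x.post → C.Reaches (Sum.inr x) (Sum.inl b')

theorem condLe_refl (b : U) : C.condLe b b := fun _ hx hb => reaches_post hx hb

theorem condLe_trans {b c d : U} (h : C.condLe b c) (h' : C.condLe c d) : C.condLe b d := by
  intro x hx hb
  obtain ⟨y, hy, hc, hxy⟩ := (h x hx hb).exists_producer
  exact hxy.trans (h' y hy hc)

/-- `x` is a node of `C`. -/
def IsNode (C : CausalNet U A) : U ⊕ Transition U A → Prop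
  | Sum.inl b => b ∈ C.conds
  | Sum.inr x => x ∈ C.events

-- All arcs leaving `e` end in fresh conditions, so a path followed backwards from a node of `C`
-- stays in `C`.
open Classical in
theorem flow_of_flow_insert (hfresh : ∀ b ∈ e.post, b ∉ C.conds) {x y : U ⊕ Transition U A}
    (h : flow (insert e C.events) x y) (hy : C.IsNode y) : flow C.events x y ∧ C.IsNode x := by
  rcases x with b | x <;> rcases y with c | y
  · exact h.elim
  · exact ⟨⟨hy, h.2⟩, C.pre_subset y hy b h.2⟩
  · rcases Finset.mem_insert.1 h.1 with rfl | hx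
    · exact absurd hy (hfresh c h.2)
    · exact ⟨⟨hx, h.2⟩, hx⟩
  · exact h.elim

open Classical in
theorem transGen_of_transGen_insert (hfresh : ∀ b ∈ e.post, b ∉ C.conds)
    {x y : U ⊕ Transition U A} (h : Relation.TransGen (flow (insert e C.events)) x y)
    (hy : C.IsNode y) : Relation.TransGen (flow C.events) x y := by
  induction h with
  | single h => exact .single (flow_of_flow_insert hfresh h hy).1
  | tail _ h ih =>
    obtain ⟨h1, h2⟩ := flow_of_flow_insert hfresh h hy
    exact (ih h2).tail h1

open Classical in
/-- The causal net obtained from `C` by adding the event `e`, with fresh post-set. -/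
noncomputable def extend (C : CausalNet U A) (e : Transition U A) (hne : e.pre ≠ 0)
    (hpre : e.pre ≤ C.maxConds.val) (hpost : e.post.Nodup)
    (hfresh : ∀ b ∈ e.post, b ∉ C.conds) : CausalNet U A where
  conds := C.conds ∪ e.post.toFinset
  events := insert e C.events
  pre_ne x hx := by
    rcases Finset.mem_insert.1 hx with rfl | hx
    · exact hne
    · exact C.pre_ne x hx
  pre_subset x hx b hb := by
    rcases Finset.mem_insert.1 hx with rfl | hx
    · exact Finset.mem_union_left _ (mem_maxConds.1 (Multiset.mem_of_le hpre hb)).1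
    · exact Finset.mem_union_left _ (C.pre_subset x hx b hb)
  post_subset x hx b hb := by
    rcases Finset.mem_insert.1 hx with rfl | hx
    · exact Finset.mem_union_right _ (Multiset.mem_toFinset.2 hb)
    · exact Finset.mem_union_left _ (C.post_subset x hx b hb)
  acyclic x hx := by
    have hmax : ∀ b ∈ e.pre, b ∈ C.conds ∧ ∀ x ∈ C.events, b ∉ x.pre :=
      fun b hb => mem_maxConds.1 (Multiset.mem_of_le hpre hb)
    -- A cycle through a node of `C` would lie in `C`, and a condition outside `C` has no outgoing
    -- arc. A cycle through a new `e` would contain a path from `e` to one of its preconditions;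
    -- that path would lie in `C`, so `e` would not be new.
    by_cases hn : C.IsNode x
    · exact C.acyclic x (transGen_of_transGen_insert hfresh hx hn)
    · rcases x with b | x
      · obtain ⟨c | y, hxy, -⟩ := Relation.TransGen.head'_iff.1 hx
        · exact hxy
        · rcases Finset.mem_insert.1 hxy.1 with rfl | hy
          · exact hn (hmax b hxy.2).1
          · exact hn (C.pre_subset y hy b hxy.2)
      · obtain ⟨c | z, hxz, hzx⟩ := Relation.TransGen.tail'_iff.1 hx
        · obtain rfl := (Finset.mem_insert.1 hzx.1).resolve_right hn
          rcases Relation.reflTransGen_iff_eq_or_transGen.1 hxz with h | h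
          · cases h
          · obtain ⟨d | w, hw, -⟩ := Relation.TransGen.head'_iff.1
              (transGen_of_transGen_insert hfresh h (hmax c hzx.2).1)
            · exact hn hw.1
            · exact hw
        · exact hzx
  producers_le_one b _ := by
    rw [Finset.card_le_one]
    simp only [producers, Finset.mem_filter, Finset.mem_insert]
    rintro x ⟨rfl | hx, hbx⟩ y ⟨rfl | hy, hby⟩
    · rfl
    · exact absurd (C.post_subset y hy b hby) (hfresh b hbx)
    · exact absurd (C.post_subset x hx b hbx) (hfresh b hby)
    · exact producer_unique hx hbx hy hby
  consumers_le_one b _ := by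
    rw [Finset.card_le_one]
    simp only [consumers, Finset.mem_filter, Finset.mem_insert]
    have hmax : ∀ b ∈ e.pre, ∀ x ∈ C.events, b ∉ x.pre :=
      fun b hb => (mem_maxConds.1 (Multiset.mem_of_le hpre hb)).2
    rintro x ⟨rfl | hx, hbx⟩ y ⟨rfl | hy, hby⟩
    · rfl
    · exact absurd hby (hmax b hbx y hy)
    · exact absurd hbx (hmax b hby x hx)
    · exact Finset.card_le_one.1 (C.consumers_le_one b (C.pre_subset x hx b hbx)) x
        (by simp [consumers, hx, hbx]) y (by simp [consumers, hy, hby])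
  pre_nodup x hx := by
    rcases Finset.mem_insert.1 hx with rfl | hx
    · exact Multiset.nodup_of_le hpre C.maxConds.nodup
    · exact C.pre_nodup x hx
  post_nodup x hx := by
    rcases Finset.mem_insert.1 hx with rfl | hx
    · exact hpost
    · exact C.post_nodup x hx

theorem step_extend (hne : e.pre ≠ 0) (hpre : e.pre ≤ C.maxConds.val) (hpost : e.post.Nodup)
    (hfresh : ∀ b ∈ e.post, b ∉ C.conds) : C.Step e (C.extend e hne hpre hpost hfresh) := by
  classical
  refine ⟨hpre, ?_, ?_, ?_⟩
  · simp only [extend]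
  · simp only [extend]
  · ext b
    simp only [mem_minConds, extend, Finset.mem_union, Multiset.mem_toFinset, Finset.mem_insert,
      forall_eq_or_imp]
    constructor
    · rintro ⟨hb | hb, h1, h2⟩
      · exact ⟨hb, h2⟩
      · exact absurd hb h1
    · rintro ⟨hb, h2⟩
      exact ⟨Or.inl hb, fun h => hfresh b h hb, h2⟩

end CausalNet

/-! ### Effect of one move on paths and on the causal preorder. -/

namespace CausalNet

variable {U A : Type*} {C C' : CausalNet U A} {e : Transition U A}

namespace Step

variable (h : C.Step e C')
include h

theorem mem_events {x : Transition U A} : x ∈ C'.events ↔ x = e ∨ x ∈ C.events := by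
  classical
  rw [h.2.1, Finset.mem_insert]

theorem mem_conds {b : U} : b ∈ C'.conds ↔ b ∈ C.conds ∨ b ∈ e.post := by
  classical
  rw [h.2.2.1, Finset.mem_union, Multiset.mem_toFinset]

theorem mem_maxConds_of_pre {b : U} (hb : b ∈ e.pre) : b ∈ C.maxConds :=
  Multiset.mem_of_le h.1 hb

theorem event_mem : e ∈ C'.events := h.mem_events.2 (Or.inl rfl)

theorem exists_mem_pre : ∃ b, b ∈ e.pre := Multiset.exists_mem_of_ne_zero (C'.pre_ne e h.event_mem)

theorem event_notMem : e ∉ C.events := fun he => by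
  obtain ⟨b, hb⟩ := h.exists_mem_pre
  exact (C.mem_maxConds.1 (h.mem_maxConds_of_pre hb)).2 e he hb

/-- Freshness is not part of `Step`. An old initial condition would stop being initial, although
`Min` is preserved, and any other old condition would get a second producer. -/
theorem fresh {b : U} (hb : b ∈ e.post) : b ∉ C.conds := fun hbC => by
  by_cases hmin : b ∈ C.minConds
  · rw [← h.2.2.2] at hmin
    exact (CausalNet.mem_minConds.1 hmin).2 e h.event_mem hb
  · simp only [CausalNet.mem_minConds, not_and, not_forall, not_not] at hmin
    obtain ⟨x, hx, hbx⟩ := hmin hbC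
    have hxe : x = e := producer_unique (h.mem_events.2 (Or.inr hx)) hbx h.event_mem hb
    exact h.event_notMem (hxe ▸ hx)

theorem mem_maxConds_iff {b : U} :
    b ∈ C'.maxConds ↔ (b ∈ C.maxConds ∧ b ∉ e.pre) ∨ b ∈ e.post := by
  simp only [CausalNet.mem_maxConds, h.mem_conds, h.mem_events, forall_eq_or_imp]
  constructor
  · rintro ⟨hb | hb, h1, h2⟩
    · exact Or.inl ⟨⟨hb, h2⟩, h1⟩
    · exact Or.inr hb
  · rintro (⟨⟨hb, h2⟩, h1⟩ | hb)
    · exact ⟨Or.inl hb, h1, h2⟩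
    · exact ⟨Or.inr hb, fun h1 => h.fresh hb (CausalNet.mem_maxConds.1 (h.mem_maxConds_of_pre h1)).1,
        fun x hx hbx => h.fresh hb (C.pre_subset x hx b hbx)⟩

theorem reaches_iff {x y : U ⊕ Transition U A} (hy : C.IsNode y) :
    C'.Reaches x y ↔ C.Reaches x y := by
  classical
  unfold Reaches
  rw [h.2.1, Relation.reflTransGen_iff_eq_or_transGen, Relation.reflTransGen_iff_eq_or_transGen]
  refine or_congr_right ⟨fun hxy => transGen_of_transGen_insert (fun b => h.fresh) hxy hy,
    fun hxy => Relation.TransGen.mono ?_ _ _ hxy⟩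
  rintro (b | x) (c | y) hxy
  · exact hxy
  · exact ⟨Finset.mem_insert_of_mem hxy.1, hxy.2⟩
  · exact ⟨Finset.mem_insert_of_mem hxy.1, hxy.2⟩
  · exact hxy

/-- The causes of the new event can be read off in the old net from its preconditions. -/
theorem reaches_event_iff {x : Transition U A} (hx : x ∈ C.events) :
    C'.Reaches (Sum.inr x) (Sum.inr e) ↔ ∃ r ∈ e.pre, C.Reaches (Sum.inr x) (Sum.inl r) := by
  have hnode : ∀ r ∈ e.pre, C.IsNode (Sum.inl r) :=
    fun r hr => (CausalNet.mem_maxConds.1 (h.mem_maxConds_of_pre hr)).1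
  constructor
  · intro hxe
    obtain ⟨r, hr, -, hxr⟩ := hxe.exists_pre (by rintro rfl; exact h.event_notMem hx)
    exact ⟨r, hr, (h.reaches_iff (hnode r hr)).1 hxr⟩
  · rintro ⟨r, hr, hxr⟩
    exact ((h.reaches_iff (hnode r hr)).2 hxr).trans (reaches_pre h.event_mem hr)

theorem reaches_post_iff {x : Transition U A} {b : U} (hb : b ∈ e.post) :
    C'.Reaches (Sum.inr x) (Sum.inl b) ↔ C'.Reaches (Sum.inr x) (Sum.inr e) := by
  constructor
  · intro hxb
    obtain ⟨y, hy, hby, hxy⟩ := hxb.exists_producer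
    rwa [producer_unique hy hby h.event_mem hb] at hxy
  · exact fun hxe => hxe.trans (reaches_post h.event_mem hb)

theorem not_reaches {y : U ⊕ Transition U A} (hy : C.IsNode y) : ¬ C'.Reaches (Sum.inr e) y := by
  intro hey
  rcases Relation.ReflTransGen.cases_head ((h.reaches_iff hy).1 hey) with rfl | ⟨b | x, hz, -⟩
  · exact h.event_notMem hy
  · exact h.event_notMem hz.1
  · exact hz

theorem condLe_old_iff {b b' : U} (hb : b ∈ C.conds) (hb' : b' ∈ C.conds) :
    C'.condLe b b' ↔ C.condLe b b' := by
  constructor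
  · intro hle x hx hbx
    exact (h.reaches_iff (y := Sum.inl b') hb').1 (hle x (h.mem_events.2 (Or.inr hx)) hbx)
  · intro hle x hx hbx
    rcases h.mem_events.1 hx with rfl | hx
    · exact absurd hb (h.fresh hbx)
    · exact (h.reaches_iff (y := Sum.inl b') hb').2 (hle x hx hbx)

theorem condLe_new {b b' : U} (hb : b ∈ e.post) (hb' : b' ∈ e.post) : C'.condLe b b' := by
  intro x hx hbx
  rw [producer_unique hx hbx h.event_mem hb]
  exact reaches_post h.event_mem hb'

theorem condLe_old_new_iff {b b' : U} (hb : b ∈ C.conds) (hb' : b' ∈ e.post) :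
    C'.condLe b b' ↔ ∃ r ∈ e.pre, C.condLe b r := by
  constructor
  · intro hle
    by_cases hx : ∃ x ∈ C.events, b ∈ x.post
    · obtain ⟨x, hx, hbx⟩ := hx
      obtain ⟨r, hr, hxr⟩ := (h.reaches_event_iff hx).1
        ((h.reaches_post_iff hb').1 (hle x (h.mem_events.2 (Or.inr hx)) hbx))
      refine ⟨r, hr, fun y hy hby => ?_⟩
      rwa [producer_unique hy hby hx hbx]
    -- Without a producer `b` is below every condition; some `r` exists because pre-sets are
    -- nonempty.
    · push Not at hx
      obtain ⟨r, hr⟩ := h.exists_mem_pre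
      exact ⟨r, hr, fun y hy hby => absurd hby (hx y hy)⟩
  · rintro ⟨r, hr, hbr⟩ x hx hbx
    rcases h.mem_events.1 hx with rfl | hx
    · exact absurd hb (h.fresh hbx)
    · exact (h.reaches_post_iff hb').2 ((h.reaches_event_iff hx).2 ⟨r, hr, hbr x hx hbx⟩)

theorem not_condLe_new_old {b b' : U} (hb : b ∈ e.post) (hb' : b' ∈ C.conds) :
    ¬ C'.condLe b b' := fun hle => h.not_reaches (y := Sum.inl b') hb' (hle e h.event_mem hb)

end Step
end CausalNet

/-! ### Extending an isomorphism of events by one pair -/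

section EventIso

variable {U A : Type*} {C₁ C₂ C₁' C₂' : CausalNet U A} {e₁ e₂ : Transition U A}
  {f : Set (Transition U A × Transition U A)}

/-- The converse of a relation between events. -/
def eventSwap (f : Set (Transition U A × Transition U A)) : Set (Transition U A × Transition U A) :=
  {x | (x.2, x.1) ∈ f}

theorem IsEventIso.swap (hf : IsEventIso C₁ C₂ f) : IsEventIso C₂ C₁ (eventSwap f) where
  mem x y h := (hf.mem y x h).symm
  left := hf.right
  right := hf.left
  order x y x' y' h h' := (hf.order y x y' x' h h').symm
  label x y h := (hf.label y x h).symm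

/-- `e₁` and `e₂` have corresponding causes under `f`. -/
def SameCauses (C₁ C₂ : CausalNet U A) (f : Set (Transition U A × Transition U A))
    (e₁ e₂ : Transition U A) : Prop :=
  ∀ x y, (x, y) ∈ f → ((∃ r ∈ e₁.pre, C₁.Reaches (Sum.inr x) (Sum.inl r)) ↔
    ∃ r ∈ e₂.pre, C₂.Reaches (Sum.inr y) (Sum.inl r))

theorem SameCauses.swap (h : SameCauses C₁ C₂ f e₁ e₂) :
    SameCauses C₂ C₁ (eventSwap f) e₂ e₁ :=
  fun x y hxy => (h y x hxy).symm

theorem IsEventIso.sameCauses (hf : IsEventIso C₁ C₂ f) (h₁ : C₁.Step e₁ C₁')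
    (h₂ : C₂.Step e₂ C₂') (hf' : IsEventIso C₁' C₂' (insert (e₁, e₂) f)) :
    SameCauses C₁ C₂ f e₁ e₂ := by
  intro x y hxy
  obtain ⟨hx, hy⟩ := hf.mem x y hxy
  rw [← h₁.reaches_event_iff hx, ← h₂.reaches_event_iff hy]
  exact hf'.order x y e₁ e₂ (Set.mem_insert_of_mem _ hxy) (Set.mem_insert _ _)

/-- No new event reaches an old one and the order on old events is unchanged, so only paths from old
events to the new ones need comparison; `hc` does that. -/
theorem IsEventIso.insert (hf : IsEventIso C₁ C₂ f) (h₁ : C₁.Step e₁ C₁')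
    (h₂ : C₂.Step e₂ C₂') (hl : e₁.label = e₂.label) (hc : SameCauses C₁ C₂ f e₁ e₂) :
    IsEventIso C₁' C₂' (insert (e₁, e₂) f) where
  mem x y h := by
    rw [h₁.mem_events, h₂.mem_events]
    rcases h with h | h
    · cases h
      exact ⟨Or.inl rfl, Or.inl rfl⟩
    · exact ⟨Or.inr (hf.mem x y h).1, Or.inr (hf.mem x y h).2⟩
  left x hx := by
    rcases h₁.mem_events.1 hx with rfl | hx
    · refine ⟨e₂, Set.mem_insert _ _, ?_⟩
      rintro y (h | h)
      · cases h
        rfl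
      · exact absurd (hf.mem x y h).1 h₁.event_notMem
    · obtain ⟨y, hy, huniq⟩ := hf.left x hx
      refine ⟨y, Set.mem_insert_of_mem _ hy, ?_⟩
      rintro z (h | h)
      · cases h
        exact absurd hx h₁.event_notMem
      · exact huniq z h
  right y hy := by
    rcases h₂.mem_events.1 hy with rfl | hy
    · refine ⟨e₁, Set.mem_insert _ _, ?_⟩
      rintro x (h | h)
      · cases h
        rfl
      · exact absurd (hf.mem x y h).2 h₂.event_notMem
    · obtain ⟨x, hx, huniq⟩ := hf.right y hy
      refine ⟨x, Set.mem_insert_of_mem _ hx, ?_⟩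
      rintro z (h | h)
      · cases h
        exact absurd hy h₂.event_notMem
      · exact huniq z h
  order x y x' y' h h' := by
    change C₁'.Reaches _ _ ↔ C₂'.Reaches _ _
    rcases h with h | h <;> rcases h' with h' | h'
    · cases h
      cases h'
      exact ⟨fun _ => .refl, fun _ => .refl⟩
    · cases h
      exact iff_of_false (h₁.not_reaches (y := Sum.inr x') (hf.mem x' y' h').1)
        (h₂.not_reaches (y := Sum.inr y') (hf.mem x' y' h').2)
    · cases h'
      rw [h₁.reaches_event_iff (hf.mem x y h).1, h₂.reaches_event_iff (hf.mem x y h).2]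
      exact hc x y h
    · rw [h₁.reaches_iff (y := Sum.inr x') (hf.mem x' y' h').1,
        h₂.reaches_iff (y := Sum.inr y') (hf.mem x' y' h').2]
      exact hf.order x y x' y' h h'
  label x y h := by
    rcases h with h | h
    · cases h
      exact hl
    · exact hf.label x y h

/-- Two conditions correspond under `f`: both are initial, or their producers are related. -/
def condRel (C₁ C₂ : CausalNet U A) (f : Set (Transition U A × Transition U A)) (b₁ b₂ : U) :
    Prop :=
  (b₁ ∈ C₁.minConds ∧ b₂ ∈ C₂.minConds) ∨ ∃ x y, (x, y) ∈ f ∧ b₁ ∈ x.post ∧ b₂ ∈ y.post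

theorem condRel_swap {b₁ b₂ : U} : condRel C₂ C₁ (eventSwap f) b₂ b₁ ↔ condRel C₁ C₂ f b₁ b₂ := by
  constructor
  · rintro (⟨h, h'⟩ | ⟨x, y, hxy, h, h'⟩)
    · exact Or.inl ⟨h', h⟩
    · exact Or.inr ⟨y, x, hxy, h', h⟩
  · rintro (⟨h, h'⟩ | ⟨x, y, hxy, h, h'⟩)
    · exact Or.inl ⟨h', h⟩
    · exact Or.inr ⟨y, x, hxy, h', h⟩

/-- This has the shape of `nextRel`: old conditions keep their producers, and the new ones are
produced by `e₁` and `e₂`. -/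
theorem condRel_insert_iff (hf : IsEventIso C₁ C₂ f) (h₁ : C₁.Step e₁ C₁') (h₂ : C₂.Step e₂ C₂')
    {b₁ b₂ : U} : condRel C₁' C₂' (insert (e₁, e₂) f) b₁ b₂ ↔
      (b₁ ∈ C₁.conds ∧ b₂ ∈ C₂.conds ∧ condRel C₁ C₂ f b₁ b₂) ∨ (b₁ ∈ e₁.post ∧ b₂ ∈ e₂.post) := by
  unfold condRel
  rw [h₁.2.2.2, h₂.2.2.2]
  constructor
  · rintro (⟨h, h'⟩ | ⟨x, y, hxy | hxy, h, h'⟩)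
    · exact Or.inl ⟨(CausalNet.mem_minConds.1 h).1, (CausalNet.mem_minConds.1 h').1,
        Or.inl ⟨h, h'⟩⟩
    · cases hxy
      exact Or.inr ⟨h, h'⟩
    · obtain ⟨hx, hy⟩ := hf.mem x y hxy
      exact Or.inl ⟨C₁.post_subset x hx _ h, C₂.post_subset y hy _ h', Or.inr ⟨x, y, hxy, h, h'⟩⟩
  · rintro (⟨-, -, h | ⟨x, y, hxy, h⟩⟩ | h)
    · exact Or.inl h
    · exact Or.inr ⟨x, y, Set.mem_insert_of_mem _ hxy, h⟩
    · exact Or.inr ⟨e₁, e₂, Set.mem_insert _ _, h⟩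

/-- Each condition consumed by `e₁` precedes one that corresponds to a condition consumed by
`e₂`. -/
def PreMatch (C₁ C₂ : CausalNet U A) (f : Set (Transition U A × Transition U A))
    (e₁ e₂ : Transition U A) : Prop :=
  ∀ b ∈ e₁.pre, ∃ c ∈ e₁.pre, ∃ d ∈ e₂.pre, C₁.condLe b c ∧ condRel C₁ C₂ f c d

/-- A cause `x` of `e₁` lies below the producer of some matched precondition `c`. Having a producer,
`c` is not initial, so its partner `d` is produced by the `f`-image of that producer, which lies
above `y`. -/
theorem PreMatch.reaches (hf : IsEventIso C₁ C₂ f) (h : PreMatch C₁ C₂ f e₁ e₂)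
    {x y : Transition U A} (hxy : (x, y) ∈ f)
    (hx : ∃ r ∈ e₁.pre, C₁.Reaches (Sum.inr x) (Sum.inl r)) :
    ∃ r ∈ e₂.pre, C₂.Reaches (Sum.inr y) (Sum.inl r) := by
  obtain ⟨r, hr, hxr⟩ := hx
  obtain ⟨c, hc, d, hd, hrc, hcd⟩ := h r hr
  obtain ⟨z, hz, hrz, hxz⟩ := hxr.exists_producer
  obtain ⟨w, hw, hcw, hzw⟩ := (hrc z hz hrz).exists_producer
  rcases hcd with ⟨hmin, -⟩ | ⟨v, v', hv, hcv, hdv⟩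
  · exact absurd hcw ((CausalNet.mem_minConds.1 hmin).2 w hw)
  · obtain ⟨hv1, hv2⟩ := hf.mem v v' hv
    obtain rfl := CausalNet.producer_unique hw hcw hv1 hcv
    have hyv : C₂.Reaches (Sum.inr y) (Sum.inr v') := (hf.order x y w v' hxy hv).1 (hxz.trans hzw)
    exact ⟨d, hd, hyv.trans (CausalNet.reaches_post hv2 hdv)⟩

theorem sameCauses_of_preMatch (hf : IsEventIso C₁ C₂ f) (h : PreMatch C₁ C₂ f e₁ e₂)
    (h' : PreMatch C₂ C₁ (eventSwap f) e₂ e₁) : SameCauses C₁ C₂ f e₁ e₂ :=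
  fun _ _ hxy => ⟨h.reaches hf hxy, h'.reaches hf.swap hxy⟩

/-- The match is found at a precondition `c` above `b` that is maximal in the causal preorder: its
producer is a maximal cause of `e₁`, so its image is a maximal cause of `e₂` and produces a
precondition of `e₂`. -/
theorem SameCauses.preMatch (hf : IsEventIso C₁ C₂ f) (h₁ : C₁.Step e₁ C₁') (h₂ : C₂.Step e₂ C₂')
    (h : SameCauses C₁ C₂ f e₁ e₂) : PreMatch C₁ C₂ f e₁ e₂ := by
  classical
  have hconds₁ : ∀ r ∈ e₁.pre, r ∈ C₁.conds :=
    fun r hr => (CausalNet.mem_maxConds.1 (h₁.mem_maxConds_of_pre hr)).1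
  have hconds₂ : ∀ r ∈ e₂.pre, r ∈ C₂.conds :=
    fun r hr => (CausalNet.mem_maxConds.1 (h₂.mem_maxConds_of_pre hr)).1
  intro b hb
  let _ : Preorder U :=
    { le := C₁.condLe
      le_refl := CausalNet.condLe_refl
      le_trans := fun _ _ _ => CausalNet.condLe_trans }
  obtain ⟨c, hbc, hmax⟩ := e₁.pre.toFinset.exists_le_maximal (Multiset.mem_toFinset.2 hb)
  have hc : c ∈ e₁.pre := Multiset.mem_toFinset.1 hmax.1
  have hmax' : ∀ r ∈ e₁.pre, C₁.condLe c r → C₁.condLe r c :=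
    fun r hr hcr => hmax.2 (Multiset.mem_toFinset.2 hr) hcr
  by_cases hcx : ∃ x ∈ C₁.events, c ∈ x.post
  · obtain ⟨x, hx, hcx⟩ := hcx
    obtain ⟨y, hxy, -⟩ := hf.left x hx
    obtain ⟨d, hd, hyd⟩ := (h x y hxy).1 ⟨c, hc, CausalNet.reaches_post hx hcx⟩
    obtain ⟨y', hy', hdy', hyy'⟩ := hyd.exists_producer
    obtain ⟨x', hxy', -⟩ := hf.right y' hy'
    have hxx' : C₁.Reaches (Sum.inr x) (Sum.inr x') := (hf.order x y x' y' hxy hxy').2 hyy'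
    -- The producer `y'` of `d` might lie strictly above `y`. Pulled back along `f` it gives a cause
    -- `x'` of `e₁` above `x`, and maximality of `c` forces `x' = x`.
    obtain ⟨r, hr, hx'r⟩ := (h x' y' hxy').2 ⟨d, hd, CausalNet.reaches_post hy' hdy'⟩
    have hcr : C₁.condLe c r := fun z hz hcz => by
      rw [CausalNet.producer_unique hz hcz hx hcx]
      exact hxx'.trans hx'r
    obtain ⟨z, hz, hrz, hx'z⟩ := hx'r.exists_producer
    obtain ⟨w, hw, hcw, hzw⟩ := (hmax' r hr hcr z hz hrz).exists_producer
    rw [CausalNet.producer_unique hw hcw hx hcx] at hzw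
    obtain rfl := Sum.inr.inj (hxx'.antisymm (hx'z.trans hzw))
    exact ⟨c, hc, d, hd, hbc, Or.inr ⟨x, y', hxy', hcx, hdy'⟩⟩
  -- An initial `c` is below everything, so by maximality no precondition of `e₁` has a producer.
  -- Thus `e₁` has no causes, nor has `e₂`, and any `d` is initial.
  · push Not at hcx
    obtain ⟨d, hd⟩ := h₂.exists_mem_pre
    refine ⟨c, hc, d, hd, hbc, Or.inl ⟨CausalNet.mem_minConds.2 ⟨hconds₁ c hc, hcx⟩,
      CausalNet.mem_minConds.2 ⟨hconds₂ d hd, fun y hy hdy => ?_⟩⟩⟩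
    obtain ⟨x, hxy, -⟩ := hf.right y hy
    obtain ⟨r, hr, hxr⟩ := (h x y hxy).2 ⟨d, hd, CausalNet.reaches_post hy hdy⟩
    obtain ⟨z, hz, hrz, -⟩ := hxr.exists_producer
    obtain ⟨w, hw, hcw, -⟩ :=
      (hmax' r hr (fun v hv hcv => absurd hcv (hcx v hv)) z hz hrz).exists_producer
    exact hcx w hw hcw

end EventIso

/-! ### Corresponding steps of processes and ordered indexed markings -/

/-- Naming tokens by maximal conditions through a step: `C` moves to `C'` through `e`, and the
tokens `k`, of which `u` is untouched, become `k'`. -/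
structure TokenStep {U S A : Type*} (C C' : CausalNet U A) (e : Transition U A) (g g' : Token S → U)
    (k u k' : IndexedMarking S) : Prop where
  step : C.Step e C'
  bij : Set.BijOn g k C.maxConds
  subset : u ⊆ k
  subset' : u ⊆ k'
  mem_iff : ∀ p ∈ k, p ∈ u ↔ g p ∉ e.pre
  eq : ∀ p ∈ u, g' p = g p
  bij_new : Set.BijOn g' {p | p ∈ k' ∧ p ∉ u} {b | b ∈ e.post}

namespace TokenStep

variable {U S A : Type*} {C C' : CausalNet U A} {e : Transition U A} {g g' : Token S → U}
  {k u k' : IndexedMarking S} (T : TokenStep C C' e g g' k u k')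
include T

theorem mem_conds {p : Token S} (hp : p ∈ k) : g p ∈ C.conds :=
  (CausalNet.mem_maxConds.1 (T.bij.mapsTo hp)).1

theorem mem_conds' {p : Token S} (hp : p ∈ u) : g' p ∈ C.conds :=
  T.eq p hp ▸ T.mem_conds (T.subset hp)

theorem mem_post {p : Token S} (hp : p ∈ k') (hu : p ∉ u) : g' p ∈ e.post :=
  T.bij_new.mapsTo ⟨hp, hu⟩

theorem exists_token {b : U} (hb : b ∈ e.pre) : ∃ p ∈ k, p ∉ u ∧ g p = b := by
  obtain ⟨p, hp, rfl⟩ := T.bij.surjOn (T.step.mem_maxConds_of_pre hb)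
  exact ⟨p, hp, fun hu => (T.mem_iff p hp).1 hu hb, rfl⟩

theorem mem_pre {p : Token S} (hp : p ∈ k) (hu : p ∉ u) : g p ∈ e.pre := by
  by_contra h
  exact hu ((T.mem_iff p hp).2 h)

theorem mem_conds_iff {p : Token S} (hp : p ∈ k') : g' p ∈ C.conds ↔ p ∈ u := by
  refine ⟨fun h => ?_, T.mem_conds'⟩
  by_contra hu
  exact T.step.fresh (T.mem_post hp hu) h

theorem mem_post_iff {p : Token S} (hp : p ∈ k') : g' p ∈ e.post ↔ p ∉ u :=
  ⟨fun h hu => T.step.fresh h (T.mem_conds' hu), T.mem_post hp⟩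

theorem bijOn : Set.BijOn g' k' C'.maxConds := by
  refine ⟨?_, ?_, ?_⟩
  · intro p hp
    rw [Finset.mem_coe, T.step.mem_maxConds_iff]
    by_cases hu : p ∈ u
    · rw [T.eq p hu]
      exact Or.inl ⟨T.bij.mapsTo (T.subset hu), (T.mem_iff p (T.subset hu)).1 hu⟩
    · exact Or.inr (T.mem_post hp hu)
  · intro p hp q hq h
    by_cases hu : p ∈ u
    · have hv : q ∈ u := by
        rw [← T.mem_conds_iff hq, ← h]
        exact T.mem_conds' hu
      rw [T.eq p hu, T.eq q hv] at h
      exact T.bij.injOn (T.subset hu) (T.subset hv) h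
    · have hv : q ∉ u := by
        rw [← T.mem_conds_iff hq, ← h, T.mem_conds_iff hp]
        exact hu
      exact T.bij_new.injOn ⟨hp, hu⟩ ⟨hq, hv⟩ h
  · intro b hb
    rw [Finset.mem_coe, T.step.mem_maxConds_iff] at hb
    rcases hb with ⟨hb, hpre⟩ | hb
    · obtain ⟨p, hp, rfl⟩ := T.bij.surjOn hb
      have hu := (T.mem_iff p hp).2 hpre
      exact ⟨p, T.subset' hu, T.eq p hu⟩
    · obtain ⟨p, ⟨hp, -⟩, rfl⟩ := T.bij_new.surjOn hb
      exact ⟨p, hp, rfl⟩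

-- The clauses of the firing rule are the cases old-old, new-new and old-new of the causal preorder
-- after the move; new-old never holds.
open Classical in
theorem le_iff {le : Token S → Token S → Prop}
    (hle : ∀ p ∈ k, ∀ q ∈ k, le p q ↔ C.condLe (g p) (g q)) {p q : Token S} (hp : p ∈ k')
    (hq : q ∈ k') :
    C'.condLe (g' p) (g' q) ↔ (p ∈ u ∧ q ∈ u ∧ le p q) ∨ (p ∈ k' \ u ∧ q ∈ k' \ u) ∨
      (p ∈ u ∧ q ∈ k' \ u ∧ ∃ r ∈ k \ u, le p r) := by
  by_cases hpu : p ∈ u <;> by_cases hqu : q ∈ u <;>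
    simp only [hpu, hqu, hp, hq, Finset.mem_sdiff, true_and, false_and, and_true, and_false,
      or_false, false_or, not_true_eq_false, not_false_eq_true]
  · rw [T.step.condLe_old_iff (T.mem_conds' hpu) (T.mem_conds' hqu), T.eq p hpu, T.eq q hqu,
      hle p (T.subset hpu) q (T.subset hqu)]
  · rw [T.step.condLe_old_new_iff (T.mem_conds' hpu) (T.mem_post hq hqu), T.eq p hpu]
    constructor
    · rintro ⟨b, hb, hle'⟩
      obtain ⟨r, hr, hru, rfl⟩ := T.exists_token hb
      exact ⟨r, ⟨hr, hru⟩, (hle p (T.subset hpu) r hr).2 hle'⟩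
    · rintro ⟨r, ⟨hr, hru⟩, hle'⟩
      exact ⟨g r, T.mem_pre hr hru, (hle p (T.subset hpu) r hr).1 hle'⟩
  · exact iff_of_false (T.step.not_condLe_new_old (T.mem_post hp hpu) (T.mem_conds' hqu)) id
  · exact iff_of_true (T.step.condLe_new (T.mem_post hp hpu) (T.mem_post hq hqu)) trivial

end TokenStep

/-! ### Two moves in parallel: updating `β` and the consumption clause. -/

section Pair

variable {U S A : Type*} {C₁ C₂ C₁' C₂' : CausalNet U A} {e₁ e₂ : Transition U A}
  {f : Set (Transition U A × Transition U A)} {g₁ g₂ g₁' g₂' : Token S → U}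
  {β : Token S → Token S → Prop}

theorem nextRel_iff {k₁ u₁ k₁' k₂ u₂ k₂' : IndexedMarking S} (hf : IsEventIso C₁ C₂ f)
    (T₁ : TokenStep C₁ C₁' e₁ g₁ g₁' k₁ u₁ k₁') (T₂ : TokenStep C₂ C₂' e₂ g₂ g₂' k₂ u₂ k₂')
    (hβ : ∀ p ∈ k₁, ∀ q ∈ k₂, β p q ↔ condRel C₁ C₂ f (g₁ p) (g₂ q)) :
    ∀ p ∈ k₁', ∀ q ∈ k₂', nextRel β u₁ k₁' u₂ k₂' p q ↔
      condRel C₁' C₂' (insert (e₁, e₂) f) (g₁' p) (g₂' q) := by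
  classical
  intro p hp q hq
  rw [condRel_insert_iff hf T₁.step T₂.step, T₁.mem_conds_iff hp, T₂.mem_conds_iff hq,
    T₁.mem_post_iff hp, T₂.mem_post_iff hq, nextRel, Finset.mem_sdiff, Finset.mem_sdiff]
  refine or_congr (and_congr_right fun hpu => and_congr_right fun hqu => ?_) (by tauto)
  rw [T₁.eq p hpu, T₂.eq q hqu, hβ p (T₁.subset hpu) q (T₂.subset hqu)]

theorem consumptionMatch_iff {O₁ O₂ : OIM S} {u₁ k₁' u₂ k₂' : IndexedMarking S}
    (T₁ : TokenStep C₁ C₁' e₁ g₁ g₁' O₁.tokens u₁ k₁')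
    (T₂ : TokenStep C₂ C₂' e₂ g₂ g₂' O₂.tokens u₂ k₂')
    (h₁ : ∀ p ∈ O₁.tokens, ∀ q ∈ O₁.tokens, O₁.le p q ↔ C₁.condLe (g₁ p) (g₁ q))
    (h₂ : ∀ p ∈ O₂.tokens, ∀ q ∈ O₂.tokens, O₂.le p q ↔ C₂.condLe (g₂ p) (g₂ q))
    (hβ : ∀ p ∈ O₁.tokens, ∀ q ∈ O₂.tokens, β p q ↔ condRel C₁ C₂ f (g₁ p) (g₂ q)) :
    ConsumptionMatch O₁ O₂ β u₁ u₂ ↔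
      PreMatch C₁ C₂ f e₁ e₂ ∧ PreMatch C₂ C₁ (eventSwap f) e₂ e₁ := by
  classical
  unfold ConsumptionMatch PreMatch
  simp only [Finset.mem_sdiff]
  constructor
  · rintro ⟨hl, hr⟩
    constructor
    · intro b hb
      obtain ⟨p, hp, hpu, rfl⟩ := T₁.exists_token hb
      obtain ⟨p', ⟨hp', hpu'⟩, q, ⟨hq, hqu⟩, hle, hrel⟩ := hl p ⟨hp, hpu⟩
      exact ⟨_, T₁.mem_pre hp' hpu', _, T₂.mem_pre hq hqu, (h₁ _ hp _ hp').1 hle,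
        (hβ _ hp' _ hq).1 hrel⟩
    · intro b hb
      obtain ⟨p, hp, hpu, rfl⟩ := T₂.exists_token hb
      obtain ⟨p', ⟨hp', hpu'⟩, q, ⟨hq, hqu⟩, hle, hrel⟩ := hr p ⟨hp, hpu⟩
      exact ⟨_, T₂.mem_pre hp' hpu', _, T₁.mem_pre hq hqu, (h₂ _ hp _ hp').1 hle,
        condRel_swap.2 ((hβ _ hq _ hp').1 hrel)⟩
  · rintro ⟨hl, hr⟩
    constructor
    · rintro p ⟨hp, hpu⟩
      obtain ⟨c, hc, d, hd, hle, hrel⟩ := hl _ (T₁.mem_pre hp hpu)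
      obtain ⟨p', hp', hpu', rfl⟩ := T₁.exists_token hc
      obtain ⟨q, hq, hqu, rfl⟩ := T₂.exists_token hd
      exact ⟨p', ⟨hp', hpu'⟩, q, ⟨hq, hqu⟩, (h₁ _ hp _ hp').2 hle, (hβ _ hp' _ hq).2 hrel⟩
    · rintro p ⟨hp, hpu⟩
      obtain ⟨c, hc, d, hd, hle, hrel⟩ := hr _ (T₂.mem_pre hp hpu)
      obtain ⟨p', hp', hpu', rfl⟩ := T₂.exists_token hc
      obtain ⟨q, hq, hqu, rfl⟩ := T₁.exists_token hd
      exact ⟨p', ⟨hp', hpu'⟩, q, ⟨hq, hqu⟩, (h₂ _ hp _ hp').2 hle,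
        (hβ _ hq _ hp').2 (condRel_swap.1 hrel)⟩

end Pair

/-- The process `π` and the ordered indexed marking `O` represent the same state: `g` names the
tokens of `O` by the maximal conditions of `π`, and preserves places and the causal preorder. -/
structure Linked {U S A : Type*} (π : FoldedNet U S A) (O : OIM S) (g : Token S → U) : Prop where
  bij : Set.BijOn g O.tokens π.net.maxConds
  place : ∀ p ∈ O.tokens, π.onCond (g p) = some p.1
  le_iff : ∀ p ∈ O.tokens, ∀ q ∈ O.tokens, O.le p q ↔ π.net.condLe (g p) (g q)

/-! ### Translating moves of processes into firings and back. -/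

section Transfer

variable {U S A : Type*} {N : PTNet S A} {π π' : FoldedNet U S A} {O O' : OIM S}
  {g : Token S → U} {e : Transition U A} {t : Transition S A} {u : IndexedMarking S}

/-- The event fixes the transition and the untouched tokens, and the firing rule fixes the generated
tokens. Only their naming by post-conditions is free: a place-preserving bijection exists because
both sides have place multiset `t.post`. -/
theorem Linked.exists_fires (hL : Linked π O g) (h : FoldedNet.Step N π e π') :
    ∃ t u O' g', O.Fires N t u O' ∧ e.label = t.label ∧
      TokenStep π.net π'.net e g g' O.tokens u O'.tokens ∧ Linked π' O' g' := by
  classical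
  obtain ⟨⟨m₀, -, hπ'⟩, hstep, hcond, -⟩ := h
  obtain ⟨t, ht⟩ := (hπ'.event_dom e).2 hstep.event_mem
  set u : IndexedMarking S := O.tokens.filter (fun p => g p ∉ e.pre) with hu
  have hsub : u ⊆ O.tokens := Finset.filter_subset _ _
  have hmem : ∀ p ∈ O.tokens, p ∈ u ↔ g p ∉ e.pre := fun p hp => by simp [hu, hp]
  have hpre : (O.tokens \ u).val.map g = e.pre := by
    refine (Multiset.Nodup.ext ?_ (π'.net.pre_nodup e hstep.event_mem)).2 fun b => ?_
    · refine Multiset.Nodup.map_on (fun p hp q hq => ?_) (Finset.nodup _)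
      exact hL.bij.injOn (Finset.mem_sdiff.1 hp).1 (Finset.mem_sdiff.1 hq).1
    · simp only [Multiset.mem_map, Finset.mem_val, Finset.mem_sdiff]
      constructor
      · rintro ⟨p, ⟨hp, hpu⟩, rfl⟩
        rw [hmem p hp, not_not] at hpu
        exact hpu
      · intro hb
        obtain ⟨p, hp, rfl⟩ := hL.bij.surjOn (hstep.mem_maxConds_of_pre hb)
        exact ⟨p, ⟨hp, fun h => (hmem p hp).1 h hb⟩, rfl⟩
  have hdel : (O.tokens \ u).val.map Prod.fst = t.pre := by
    apply Multiset.map_injective (Option.some_injective S)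
    rw [← hπ'.map_pre e t ht, ← hpre, Multiset.map_map, Multiset.map_map]
    refine Multiset.map_congr rfl fun p hp => ?_
    exact (hcond _ _ (hL.place p (Finset.mem_sdiff.1 hp).1)).symm
  have htok := IndexedMarking.toMarking_eq_add hsub hdel
  obtain ⟨hsub', hadd⟩ := IndexedMarking.subset_add_and_toMarking_add t.post u
  have hnew : (u.add t.post \ u).val.map (fun p => some p.1) =
      e.post.toFinset.val.map π'.onCond := by
    rw [Multiset.toFinset_val, Multiset.dedup_eq_self.2 (π'.net.post_nodup e hstep.event_mem),
      hπ'.map_post e t ht]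
    conv_rhs => rw [← IndexedMarking.toMarking_sdiff hsub' hadd, Multiset.map_map]
    rfl
  obtain ⟨g', hbij, hplace, heq⟩ := exists_bijOn_of_map_eq _ _ g _ _ hnew
  have hgu : ∀ p ∈ u, g' p = g p := fun p hp => heq p fun h => (Finset.mem_sdiff.1 h).2 hp
  have T : TokenStep π.net π'.net e g g' O.tokens u (u.add t.post) :=
    { step := hstep
      bij := hL.bij
      subset := hsub
      subset' := hsub'
      mem_iff := hmem
      eq := hgu
      bij_new := by
        convert hbij using 1
        · ext p
          simp
        · ext b
          simp }
  -- The preorder is pulled back from the new net, so that its laws are immediate; `T.le_iff` shows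
  -- that it obeys the firing rule.
  let O' : OIM S :=
    { tokens := u.add t.post
      le := fun p q => p ∈ u.add t.post ∧ q ∈ u.add t.post ∧ π'.net.condLe (g' p) (g' q)
      le_mem := fun _ _ h => ⟨h.1, h.2.1⟩
      le_refl := fun p hp => ⟨hp, hp, CausalNet.condLe_refl _⟩
      le_trans := fun _ _ _ h h' => ⟨h.1, h'.2.1, CausalNet.condLe_trans h.2.2 h'.2.2⟩ }
  refine ⟨t, u, O', g', ⟨hπ'.event_mem e t ht, ?_, IndexedMarking.mem_sub_iff.2 ⟨hsub, htok⟩, rfl,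
    fun p hp q hq => ?_⟩, hπ'.label_eq e t ht, T, ⟨T.bijOn, fun p hp => ?_, fun p hp q hq => ?_⟩⟩
  · rw [htok]
    exact Multiset.le_add_left _ _
  · rw [← T.le_iff hL.le_iff hp hq]
    exact ⟨fun h => h.2.2, fun h => ⟨hp, hq, h⟩⟩
  · by_cases hpu : p ∈ u
    · rw [hgu p hpu]
      exact hcond _ _ (hL.place p (hsub hpu))
    · exact hplace p (Finset.mem_sdiff.2 ⟨hp, hpu⟩)
  · exact ⟨fun h => h.2.2, fun h => ⟨hp, hq, h⟩⟩

/-- The event consumes the names of the deleted tokens and produces fresh names for the generated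
ones. Injective naming gives arcs of weight one, and the infinite supply gives freshness. -/
theorem Linked.exists_step [Infinite U] {m₀ : Multiset S} (hL : Linked π O g)
    (hπ : π.IsProcessOf N m₀) (h : O.Fires N t u O') :
    ∃ e π' g', FoldedNet.Step N π e π' ∧ e.label = t.label ∧
      TokenStep π.net π'.net e g g' O.tokens u O'.tokens ∧ Linked π' O' g' := by
  classical
  obtain ⟨htN, -, hu, htok', hle⟩ := h
  obtain ⟨hsub, htok⟩ := IndexedMarking.mem_sub_iff.1 hu
  obtain ⟨hsub', hadd⟩ := IndexedMarking.subset_add_and_toMarking_add t.post u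
  rw [← htok'] at hsub' hadd
  have hdel := IndexedMarking.toMarking_sdiff hsub htok
  have hgen := IndexedMarking.toMarking_sdiff hsub' hadd
  obtain ⟨g', hinj, hfresh', heq⟩ := exists_fresh_names g π.net.conds (O'.tokens \ u)
  have hgu : ∀ p ∈ u, g' p = g p := fun p hp => heq p fun h => (Finset.mem_sdiff.1 h).2 hp
  have hnodup : ((O.tokens \ u).val.map g).Nodup := by
    refine Multiset.Nodup.map_on (fun p hp q hq => ?_) (Finset.nodup _)
    exact hL.bij.injOn (Finset.mem_sdiff.1 hp).1 (Finset.mem_sdiff.1 hq).1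
  let e : Transition U A :=
    ⟨(O.tokens \ u).val.map g, t.label, (O'.tokens \ u).val.map g'⟩
  have hmem_pre : ∀ b, b ∈ e.pre ↔ ∃ p, (p ∈ O.tokens ∧ p ∉ u) ∧ g p = b := fun b => by
    simp only [e, Multiset.mem_map, Finset.mem_val, Finset.mem_sdiff]
  have hmem_post : ∀ b, b ∈ e.post ↔ ∃ p, (p ∈ O'.tokens ∧ p ∉ u) ∧ g' p = b := fun b => by
    simp only [e, Multiset.mem_map, Finset.mem_val, Finset.mem_sdiff]
  have hne : e.pre ≠ 0 := by
    intro h0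
    apply N.pre_ne t htN
    rw [← hdel, Multiset.map_eq_zero.1 h0, Multiset.map_zero]
  have hpre : e.pre ≤ π.net.maxConds.val := by
    refine (Multiset.le_iff_subset hnodup).2 fun b hb => ?_
    obtain ⟨p, ⟨hp, -⟩, rfl⟩ := (hmem_pre b).1 hb
    exact hL.bij.mapsTo hp
  have hpost : e.post.Nodup :=
    Multiset.Nodup.map_on (fun p hp q hq => hinj hp hq) (Finset.nodup _)
  have hfresh : ∀ b ∈ e.post, b ∉ π.net.conds := by
    intro b hb
    obtain ⟨p, hp, rfl⟩ := Multiset.mem_map.1 hb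
    exact hfresh' p hp
  have hstep := CausalNet.step_extend hne hpre hpost hfresh
  let π' : FoldedNet U S A :=
    { net := π.net.extend e hne hpre hpost hfresh
      onCond := placeOf g' (O'.tokens \ u) π.onCond
      onEvent := fun x => if x = e then some t else π.onEvent x }
  have hnew : ∀ p ∈ O'.tokens \ u, π'.onCond (g' p) = some p.1 :=
    fun p hp => placeOf_apply _ hinj hp
  have hold : ∀ b ∈ π.net.conds, π'.onCond b = π.onCond b := fun b hb =>
    placeOf_of_notMem _ fun p hp h => hfresh' p hp (h ▸ hb)
  have hevent : ∀ x t', π'.onEvent x = some t' ↔ (x = e ∧ t' = t) ∨ π.onEvent x = some t' := by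
    intro x t'
    change (if x = e then some t else π.onEvent x) = some t' ↔ _
    have hx : ∀ t', π.onEvent x = some t' → x ≠ e := fun t' h hxe =>
      hstep.event_notMem ((hπ.event_dom e).1 ⟨t', hxe ▸ h⟩)
    by_cases hxe : x = e
    · rw [if_pos hxe]
      constructor
      · intro h
        exact Or.inl ⟨hxe, (Option.some.inj h).symm⟩
      · rintro (⟨-, rfl⟩ | h)
        · rfl
        · exact absurd hxe (hx _ h)
    · simp [hxe]
  have hcongr : ∀ M : Multiset U, (∀ b ∈ M, b ∈ π.net.conds) →
      M.map π'.onCond = M.map π.onCond :=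
    fun M hM => Multiset.map_congr rfl fun b hb => hold b (hM b hb)
  have hmem : ∀ x t', π.onEvent x = some t' → x ∈ π.net.events :=
    fun x t' h => (hπ.event_dom x).1 ⟨t', h⟩
  have hπ' : π'.IsProcessOf N m₀ :=
    { cond_dom := fun b => by
        rw [hstep.mem_conds]
        by_cases hb : ∃ p ∈ O'.tokens \ u, g' p = b
        · obtain ⟨p, hp, rfl⟩ := hb
          exact iff_of_true ⟨_, hnew p hp⟩ (Or.inr (Multiset.mem_map.2 ⟨p, hp, rfl⟩))
        · have h1 : π'.onCond b = π.onCond b := dif_neg hb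
          have h2 : b ∉ e.post := fun h => hb (Multiset.mem_map.1 h)
          rw [h1, hπ.cond_dom]
          simp [h2]
      event_dom := fun x => by
        rw [hstep.mem_events, ← hπ.event_dom]
        simp only [hevent]
        constructor
        · rintro ⟨t', h | h⟩
          · exact Or.inl h.1
          · exact Or.inr ⟨t', h⟩
        · rintro (h | ⟨t', h⟩)
          · exact ⟨t, Or.inl ⟨h, rfl⟩⟩
          · exact ⟨t', Or.inr h⟩
      event_mem := fun x t' h => by
        rcases (hevent x t').1 h with ⟨-, rfl⟩ | h
        · exact htN
        · exact hπ.event_mem x t' h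
      label_eq := fun x t' h => by
        rcases (hevent x t').1 h with ⟨rfl, rfl⟩ | h
        · rfl
        · exact hπ.label_eq x t' h
      map_init := by
        rw [hstep.2.2.2, ← hπ.map_init]
        exact hcongr _ fun b hb => (CausalNet.mem_minConds.1 hb).1
      map_pre := fun x t' h => by
        rcases (hevent x t').1 h with ⟨rfl, rfl⟩ | h
        · rw [hcongr _ fun b hb => (CausalNet.mem_maxConds.1 (hstep.mem_maxConds_of_pre hb)).1,
            ← hdel, Multiset.map_map, Multiset.map_map]
          exact Multiset.map_congr rfl fun p hp => hL.place p (Finset.mem_sdiff.1 hp).1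
        · rw [hcongr _ (π.net.pre_subset x (hmem x t' h))]
          exact hπ.map_pre x t' h
      map_post := fun x t' h => by
        rcases (hevent x t').1 h with ⟨rfl, rfl⟩ | h
        · rw [← hgen, Multiset.map_map, Multiset.map_map]
          exact Multiset.map_congr rfl fun p hp => hnew p hp
        · rw [hcongr _ (π.net.post_subset x (hmem x t' h))]
          exact hπ.map_post x t' h }
  have T : TokenStep π.net π'.net e g g' O.tokens u O'.tokens :=
    { step := hstep
      bij := hL.bij
      subset := hsub
      subset' := hsub'
      mem_iff := fun p hp => by
        constructor
        · intro hpu hpe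
          obtain ⟨q, ⟨hq, hqu⟩, hqp⟩ := (hmem_pre _).1 hpe
          exact hqu (hL.bij.injOn hq hp hqp ▸ hpu)
        · intro hpe
          by_contra hpu
          exact hpe ((hmem_pre _).2 ⟨p, ⟨hp, hpu⟩, rfl⟩)
      eq := hgu
      bij_new := by
        refine ⟨fun p hp => (hmem_post _).2 ⟨p, hp, rfl⟩, fun p hp q hq h => ?_, fun b hb => ?_⟩
        · exact hinj (Finset.mem_sdiff.2 hp) (Finset.mem_sdiff.2 hq) h
        · exact (hmem_post b).1 hb }
  refine ⟨e, π', g', ⟨⟨m₀, hπ, hπ'⟩, hstep, fun b s hb => ?_, fun x t' h => ?_⟩, rfl, T,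
    ⟨T.bijOn, fun p hp => ?_, fun p hp q hq => ?_⟩⟩
  · rw [hold b ((hπ.cond_dom b).1 ⟨s, hb⟩)]
    exact hb
  · exact (hevent x t').2 (Or.inr h)
  · by_cases hpu : p ∈ u
    · rw [hgu p hpu, hold _ (T.mem_conds (hsub hpu))]
      exact hL.place p (hsub hpu)
    · exact hnew p (Finset.mem_sdiff.2 ⟨hp, hpu⟩)
  · rw [hle p hp q hq, T.le_iff hL.le_iff hp hq]

end Transfer

/-! ### The two bisimilarities -/

section Bisimilarity

variable {U S A : Type*} {N : PTNet S A}

/-- The triples `(π₁, f, π₂)` and `(O₁, O₂, β)` represent the same pair of states. -/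
structure PairLinked (π₁ : FoldedNet U S A) (f : Set (Transition U A × Transition U A))
    (π₂ : FoldedNet U S A) (O₁ O₂ : OIM S) (β : Token S → Token S → Prop) (g₁ g₂ : Token S → U) :
    Prop where
  left : Linked π₁ O₁ g₁
  right : Linked π₂ O₂ g₂
  rel_iff : ∀ p ∈ O₁.tokens, ∀ q ∈ O₂.tokens,
    β p q ↔ condRel π₁.net π₂.net f (g₁ p) (g₂ q)

variable {π₁ π₂ π₁' π₂' : FoldedNet U S A} {f : Set (Transition U A × Transition U A)}
  {O₁ O₂ O₁' O₂' : OIM S} {β : Token S → Token S → Prop} {g₁ g₂ g₁' g₂' : Token S → U}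
  {e₁ e₂ : Transition U A} {u₁ u₂ : IndexedMarking S}

theorem PairLinked.next (h : PairLinked π₁ f π₂ O₁ O₂ β g₁ g₂)
    (hf : IsEventIso π₁.net π₂.net f)
    (T₁ : TokenStep π₁.net π₁'.net e₁ g₁ g₁' O₁.tokens u₁ O₁'.tokens)
    (T₂ : TokenStep π₂.net π₂'.net e₂ g₂ g₂' O₂.tokens u₂ O₂'.tokens)
    (h₁ : Linked π₁' O₁' g₁') (h₂ : Linked π₂' O₂' g₂') :
    PairLinked π₁' (insert (e₁, e₂) f) π₂' O₁' O₂' (nextRel β u₁ O₁'.tokens u₂ O₂'.tokens)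
      g₁' g₂' :=
  ⟨h₁, h₂, nextRel_iff hf T₁ T₂ h.rel_iff⟩

theorem PairLinked.isEventIso_insert (h : PairLinked π₁ f π₂ O₁ O₂ β g₁ g₂)
    (hf : IsEventIso π₁.net π₂.net f)
    (T₁ : TokenStep π₁.net π₁'.net e₁ g₁ g₁' O₁.tokens u₁ O₁'.tokens)
    (T₂ : TokenStep π₂.net π₂'.net e₂ g₂ g₂' O₂.tokens u₂ O₂'.tokens)
    (hl : e₁.label = e₂.label) (hc : ConsumptionMatch O₁ O₂ β u₁ u₂) :
    IsEventIso π₁'.net π₂'.net (insert (e₁, e₂) f) := by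
  obtain ⟨h1, h2⟩ := (consumptionMatch_iff T₁ T₂ h.left.le_iff h.right.le_iff h.rel_iff).1 hc
  exact hf.insert T₁.step T₂.step hl (sameCauses_of_preMatch hf h1 h2)

theorem PairLinked.consumptionMatch (h : PairLinked π₁ f π₂ O₁ O₂ β g₁ g₂)
    (hf : IsEventIso π₁.net π₂.net f)
    (T₁ : TokenStep π₁.net π₁'.net e₁ g₁ g₁' O₁.tokens u₁ O₁'.tokens)
    (T₂ : TokenStep π₂.net π₂'.net e₂ g₂ g₂' O₂.tokens u₂ O₂'.tokens)
    (hf' : IsEventIso π₁'.net π₂'.net (insert (e₁, e₂) f)) :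
    ConsumptionMatch O₁ O₂ β u₁ u₂ := by
  have hs := hf.sameCauses T₁.step T₂.step hf'
  exact (consumptionMatch_iff T₁ T₂ h.left.le_iff h.right.le_iff h.rel_iff).2
    ⟨hs.preMatch hf T₁.step T₂.step, hs.swap.preMatch hf.swap T₂.step T₁.step⟩

/-- The relation on processes induced by a relation on ordered indexed markings. -/
def fcOfOIM (N : PTNet S A) (B : OIM S → OIM S → (Token S → Token S → Prop) → Prop)
    (π₁ : FoldedNet U S A) (f : Set (Transition U A × Transition U A)) (π₂ : FoldedNet U S A) :
    Prop :=
  (∃ m₀, π₁.IsProcessOf N m₀) ∧ (∃ m₀, π₂.IsProcessOf N m₀) ∧ IsEventIso π₁.net π₂.net f ∧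
    ∃ O₁ O₂ β g₁ g₂, B O₁ O₂ β ∧ PairLinked π₁ f π₂ O₁ O₂ β g₁ g₂

/-- A move becomes a firing, is answered by a firing, and the answer is realised as a move. The
consumption clause keeps the event relation an isomorphism. -/
theorem IsOIMBisimulation.isFCBisimulation [Infinite U]
    {B : OIM S → OIM S → (Token S → Token S → Prop) → Prop} (hB : IsOIMBisimulation N B) :
    IsFCBisimulation N (fcOfOIM (U := U) N B) where
  process_left _ _ _ h := h.1
  process_right _ _ _ h := h.2.1
  iso _ _ _ h := h.2.2.1
  forth := by
    rintro π₁ f π₂ ⟨-, ⟨m, hm⟩, hf, O₁, O₂, β, g₁, g₂, hO, hP⟩ e₁ π₁' hstep₁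
    obtain ⟨t₁, u₁, O₁', g₁', hF₁, hl₁, T₁, hL₁⟩ := hP.left.exists_fires hstep₁
    obtain ⟨t₂, u₂, O₂', hF₂, hO', hl, hc⟩ := hB.forth _ _ _ hO _ _ _ hF₁
    obtain ⟨e₂, π₂', g₂', hstep₂, hl₂, T₂, hL₂⟩ := hP.right.exists_step hm hF₂
    exact ⟨e₂, π₂', hstep₂, hstep₁.1.imp fun _ h => h.2, hstep₂.1.imp fun _ h => h.2,
      hP.isEventIso_insert hf T₁ T₂ (hl₁.trans (hl.trans hl₂.symm)) hc,
      O₁', O₂', _, g₁', g₂', hO', hP.next hf T₁ T₂ hL₁ hL₂⟩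
  back := by
    rintro π₁ f π₂ ⟨⟨m, hm⟩, -, hf, O₁, O₂, β, g₁, g₂, hO, hP⟩ e₂ π₂' hstep₂
    obtain ⟨t₂, u₂, O₂', g₂', hF₂, hl₂, T₂, hL₂⟩ := hP.right.exists_fires hstep₂
    obtain ⟨t₁, u₁, O₁', hF₁, hO', hl, hc⟩ := hB.back _ _ _ hO _ _ _ hF₂
    obtain ⟨e₁, π₁', g₁', hstep₁, hl₁, T₁, hL₁⟩ := hP.left.exists_step hm hF₁
    exact ⟨e₁, π₁', hstep₁, hstep₁.1.imp fun _ h => h.2, hstep₂.1.imp fun _ h => h.2,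
      hP.isEventIso_insert hf T₁ T₂ (hl₁.trans (hl.trans hl₂.symm)) hc,
      O₁', O₂', _, g₁', g₂', hO', hP.next hf T₁ T₂ hL₁ hL₂⟩

/-- The relation on ordered indexed markings induced by a relation on processes. -/
def oimOfFC (R : FoldedNet U S A → Set (Transition U A × Transition U A) → FoldedNet U S A → Prop)
    (O₁ O₂ : OIM S) (β : Token S → Token S → Prop) : Prop :=
  ∃ π₁ f π₂ g₁ g₂, R π₁ f π₂ ∧ PairLinked π₁ f π₂ O₁ O₂ β g₁ g₂

/-- The converse round trip: labels and the consumption clause are recovered from the extended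
relation being an isomorphism. -/
theorem IsFCBisimulation.isOIMBisimulation [Infinite U]
    {R : FoldedNet U S A → Set (Transition U A × Transition U A) → FoldedNet U S A → Prop}
    (hR : IsFCBisimulation N R) : IsOIMBisimulation N (oimOfFC R) where
  forth := by
    rintro O₁ O₂ β ⟨π₁, f, π₂, g₁, g₂, hπ, hP⟩ t₁ u₁ O₁' hF₁
    obtain ⟨m, hm⟩ := hR.process_left _ _ _ hπ
    have hf := hR.iso _ _ _ hπ
    obtain ⟨e₁, π₁', g₁', hstep₁, hl₁, T₁, hL₁⟩ := hP.left.exists_step hm hF₁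
    obtain ⟨e₂, π₂', hstep₂, hπ'⟩ := hR.forth _ _ _ hπ _ _ hstep₁
    obtain ⟨t₂, u₂, O₂', g₂', hF₂, hl₂, T₂, hL₂⟩ := hP.right.exists_fires hstep₂
    have hf' := hR.iso _ _ _ hπ'
    exact ⟨t₂, u₂, O₂', hF₂, ⟨_, _, _, _, _, hπ', hP.next hf T₁ T₂ hL₁ hL₂⟩,
      hl₁.symm.trans ((hf'.label _ _ (Set.mem_insert _ _)).trans hl₂),
      hP.consumptionMatch hf T₁ T₂ hf'⟩
  back := by
    rintro O₁ O₂ β ⟨π₁, f, π₂, g₁, g₂, hπ, hP⟩ t₂ u₂ O₂' hF₂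
    obtain ⟨m, hm⟩ := hR.process_right _ _ _ hπ
    have hf := hR.iso _ _ _ hπ
    obtain ⟨e₂, π₂', g₂', hstep₂, hl₂, T₂, hL₂⟩ := hP.right.exists_step hm hF₂
    obtain ⟨e₁, π₁', hstep₁, hπ'⟩ := hR.back _ _ _ hπ _ _ hstep₂
    obtain ⟨t₁, u₁, O₁', g₁', hF₁, hl₁, T₁, hL₁⟩ := hP.left.exists_fires hstep₁
    have hf' := hR.iso _ _ _ hπ'
    exact ⟨t₁, u₁, O₁', hF₁, ⟨_, _, _, _, _, hπ', hP.next hf T₁ T₂ hL₁ hL₂⟩,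
      hl₁.symm.trans ((hf'.label _ _ (Set.mem_insert _ _)).trans hl₂),
      hP.consumptionMatch hf T₁ T₂ hf'⟩

theorem minConds_of_events_eq_empty {C : CausalNet U A} (h : C.events = ∅) :
    C.minConds = C.conds := by
  ext b
  simp [CausalNet.mem_minConds, h]

theorem maxConds_of_events_eq_empty {C : CausalNet U A} (h : C.events = ∅) :
    C.maxConds = C.conds := by
  ext b
  simp [CausalNet.mem_maxConds, h]

/-- Without events every condition is initial, so the causal preorder and `condRel` are total on
conditions, as are `k × k` and `k₁ × k₂` on tokens. -/
theorem pairLinked_init {k₁ k₂ : IndexedMarking S} (h₁ : π₁.net.events = ∅)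
    (h₂ : π₂.net.events = ∅) (hb₁ : Set.BijOn g₁ k₁ π₁.net.conds)
    (hb₂ : Set.BijOn g₂ k₂ π₂.net.conds) (hp₁ : ∀ p ∈ k₁, π₁.onCond (g₁ p) = some p.1)
    (hp₂ : ∀ p ∈ k₂, π₂.onCond (g₂ p) = some p.1) :
    PairLinked π₁ ∅ π₂ (OIM.init k₁) (OIM.init k₂) (fun p q => p ∈ k₁ ∧ q ∈ k₂) g₁ g₂ where
  left := ⟨by rwa [maxConds_of_events_eq_empty h₁], hp₁, fun p hp q hq =>
    iff_of_true ⟨hp, hq⟩ fun x hx => by simp [h₁] at hx⟩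
  right := ⟨by rwa [maxConds_of_events_eq_empty h₂], hp₂, fun p hp q hq =>
    iff_of_true ⟨hp, hq⟩ fun x hx => by simp [h₂] at hx⟩
  rel_iff p hp q hq := iff_of_true ⟨hp, hq⟩ <| Or.inl <| by
    rw [minConds_of_events_eq_empty h₁, minConds_of_events_eq_empty h₂]
    exact ⟨hb₁.mapsTo hp, hb₂.mapsTo hq⟩

theorem isEventIso_empty {C₁ C₂ : CausalNet U A} (h₁ : C₁.events = ∅) (h₂ : C₂.events = ∅) :
    IsEventIso C₁ C₂ ∅ where
  mem _ _ h := h.elim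
  left x hx := by simp [h₁] at hx
  right x hx := by simp [h₂] at hx
  order _ _ _ _ h := h.elim
  label _ _ h := h.elim

/-- The causal net with conditions `K` and without events. -/
def CausalNet.discrete (A : Type*) (K : Finset U) : CausalNet U A where
  conds := K
  events := ∅
  pre_ne := by simp
  pre_subset := by simp
  post_subset := by simp
  acyclic x hx := by
    obtain ⟨y, h, -⟩ := Relation.TransGen.head'_iff.1 hx
    rcases x with b | x <;> rcases y with c | y <;> simp [flow] at h
  producers_le_one := by simp [producers]
  consumers_le_one := by simp [consumers]
  pre_nodup := by simp
  post_nodup := by simp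

theorem exists_initial_process [Infinite U] (N : PTNet S A) (k : IndexedMarking S) :
    ∃ (π : FoldedNet U S A) (g : Token S → U), π.IsInitial k.toMarking ∧
      π.IsProcessOf N k.toMarking ∧ Set.BijOn g k π.net.conds ∧
      ∀ p ∈ k, π.onCond (g p) = some p.1 := by
  classical
  obtain ⟨g, hinj, -, -⟩ := exists_fresh_names (fun _ : Token S => Classical.arbitrary U) ∅ k
  let π : FoldedNet U S A :=
    { net := CausalNet.discrete A (k.image g)
      onCond := placeOf g k fun _ => none
      onEvent := fun _ => none }
  have hevents : π.net.events = ∅ := rfl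
  have hplace : ∀ p ∈ k, π.onCond (g p) = some p.1 :=
    fun p hp => placeOf_apply (fun _ => none) hinj hp
  have hmap : π.net.conds.val.map π.onCond = k.toMarking.map some := by
    change (k.image g).val.map π.onCond = _
    rw [Finset.image_val_of_injOn hinj, IndexedMarking.toMarking, Multiset.map_map,
      Multiset.map_map]
    exact Multiset.map_congr rfl hplace
  refine ⟨π, g, ⟨hevents, ?_, ?_⟩, ?_, ?_, hplace⟩
  · rwa [minConds_of_events_eq_empty hevents]
  · rwa [maxConds_of_events_eq_empty hevents]
  · exact
      { cond_dom := fun b => by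
          change _ ↔ b ∈ k.image g
          rw [Finset.mem_image]
          constructor
          · rintro ⟨s, hs⟩
            by_contra hb
            have : π.onCond b = none := dif_neg hb
            rw [this] at hs
            cases hs
          · rintro ⟨p, hp, rfl⟩
            exact ⟨_, hplace p hp⟩
        event_dom := fun x => by simp [π, CausalNet.discrete]
        event_mem := fun _ _ h => by cases h
        label_eq := fun _ _ h => by cases h
        map_init := by rwa [minConds_of_events_eq_empty hevents]
        map_pre := fun _ _ h => by cases h
        map_post := fun _ _ h => by cases h }
  · change Set.BijOn g k (k.image g : Finset U)
    rw [Finset.coe_image]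
    exact hinj.bijOn_image

theorem FoldedNet.IsInitial.exists_bijOn [Infinite U] {π : FoldedNet U S A}
    {k : IndexedMarking S} (h : π.IsInitial k.toMarking) :
    ∃ g : Token S → U, Set.BijOn g k π.net.conds ∧ ∀ p ∈ k, π.onCond (g p) = some p.1 := by
  obtain ⟨he, hmin, -⟩ := h
  rw [minConds_of_events_eq_empty he] at hmin
  obtain ⟨g, hg, hp, -⟩ := exists_bijOn_of_map_eq (fun p : Token S => some p.1) π.onCond
    (fun _ => Classical.arbitrary U) k π.net.conds (by
      rw [hmin, IndexedMarking.toMarking, Multiset.map_map]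
      rfl)
  exact ⟨g, hg, hp⟩

end Bisimilarity

theorem mainTheorem3 {S A : Type*} [Finite S] [Finite A] (U : Type*) [Infinite U]
    (N : PTNet S A) (m₁ m₂ : Multiset S) :
    OIMBisimilar N m₁ m₂ ↔ FCBisimilar U N m₁ m₂ := by
  constructor
  · rintro ⟨B, hB, k₁, k₂, -, rfl, -, rfl, hinit⟩
    obtain ⟨π₁, g₁, hI₁, hπ₁, hb₁, hp₁⟩ := exists_initial_process (U := U) N k₁
    obtain ⟨π₂, g₂, hI₂, hπ₂, hb₂, hp₂⟩ := exists_initial_process (U := U) N k₂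
    exact ⟨fcOfOIM N B, hB.isFCBisimulation, π₁, π₂, hI₁, hI₂, ⟨_, hπ₁⟩, ⟨_, hπ₂⟩,
      isEventIso_empty hI₁.1 hI₂.1, _, _, _, g₁, g₂, hinit,
      pairLinked_init hI₁.1 hI₂.1 hb₁ hb₂ hp₁ hp₂⟩
  · rintro ⟨R, hR, π₁, π₂, hI₁, hI₂, hinit⟩
    obtain ⟨k₁, hk₁, rfl⟩ := IndexedMarking.exists_isClosed m₁
    obtain ⟨k₂, hk₂, rfl⟩ := IndexedMarking.exists_isClosed m₂
    obtain ⟨g₁, hb₁, hp₁⟩ := hI₁.exists_bijOn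
    obtain ⟨g₂, hb₂, hp₂⟩ := hI₂.exists_bijOn
    exact ⟨oimOfFC R, hR.isOIMBisimulation, k₁, k₂, hk₁, rfl, hk₂, rfl, π₁, ∅, π₂, g₁, g₂, hinit,
      pairLinked_init hI₁.1 hI₂.1 hb₁ hb₂ hp₁ hp₂⟩
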